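/- Let $n\ge 0$ be an integer, let $S_n$ and $A_n$ be the symmetric and alternating groups on $n$ letters, and work over $\mathbb{C}$. Let $\psi(A_n)$ be the permutation representation of $A_n$ on itself by conjugation, let $\psi(A_n)\uparrow_{A_n}^{S_n}$ be the representation of $S_n$ induced from it, and let $\psi(S_n,A_n)$ be the permutation representation of $S_n$ on the set $A_n$ by conjugation. For a representation $V$ of $S_n$ let $\omega(V)=\mathrm{sgn}\otimes V$; $V$ is self-conjugate if $V\cong\omega(V)$. For a finite-dimensional representation with character $\chi$, its Frobenius characteristic is $\mathrm{ch}=\frac1{n!}\sum_{\sigma\in S_n}\chi(\sigma)\,p_{\mathrm{type}(\sigma)}$, where $\mathrm{type}(\sigma)$ is the cycle type of $\sigma$ (a partition of $n$, fixed points included) and $p_\mu=\prod_i p_{\mu_i}$ is the power sum symmetric function. Write $\ell(\mu)$ for the number of parts of a partition $\mu$, and $DO_n$ for the set of partitions of $n$ whose parts are all odd and distinct. Then: 1. $\psi(A_n)\uparrow_{A_n}^{S_n}$ is self-conjugate of degree $n!$. 2. For $n\ge 2$ its Frobenius characteristic is $$2\sum_{\lambda\in DO_n}p_\lambda+\sum_{\substack{\mu\vdash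 n,\ \mu\notin DO_n\\ n-\ell(\mu)\text{ even}}}p_\mu .$$ 3. For $n\ge 2$, $\psi(A_n)\uparrow_{A_n}^{S_n}\cong\psi(S_n,A_n)\oplus\omega(\psi(S_n,A_n))$. 4. For $n\ne 3$, every irreducible representation of $S_n$ occurs in $\psi(A_n)\uparrow_{A_n}^{S_n}$. 5. For $n=3$, $\mathrm{ch}\big(\psi(A_3)\uparrow_{A_3}^{S_3}\big)=3(h_3+e_3)$, where $h_3$ and $e_3$ are the complete homogeneous and elementary symmetric functions of degree 3. -/

import Mathlib

noncomputable section

/-- The permutation representation `ψ(G)` over `ℂ` of a group `G` on itself by conjugation;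
the basis vector of `x` is sent by `g` to the basis vector of `g x g⁻¹`. -/
def conjRep (G : Type*) [Group G] : Representation ℂ G (MonoidAlgebra ℂ G) :=
  (Representation.ofMulAction ℂ (MulAut G) G).comp MulAut.conj

/-- The permutation representation `ψ(G, H)` over `ℂ` of `G` on a normal subgroup `H` by
conjugation; the basis vector of `x` is sent by `g` to the basis vector of `g x g⁻¹`. -/
def conjRepOn {G : Type*} [Group G] (H : Subgroup G) [H.Normal] :
    Representation ℂ G (MonoidAlgebra ℂ H) :=
  (Representation.ofMulAction ℂ (MulAut H) H).comp MulAut.conjNormal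

/-- The sign representation of the symmetric group on `n` letters:
`σ` acts on `ℂ` as multiplication by `sign σ`. -/
def signRep (n : ℕ) : Representation ℂ (Equiv.Perm (Fin n)) ℂ where
  toFun σ := ((Equiv.Perm.sign σ : ℤ) : ℂ) • LinearMap.id
  map_one' := by ext; simp
  map_mul' σ τ := by ext; simp [mul_comm]

/-- The operation `ω` on representations of the symmetric group: tensoring with the sign. -/
def omegaRep {n : ℕ} {V : Type*} [AddCommGroup V] [Module ℂ V]
    (ρ : Representation ℂ (Equiv.Perm (Fin n)) V) :
    Representation ℂ (Equiv.Perm (Fin n)) (TensorProduct ℂ ℂ V) :=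
  (signRep n).tprod ρ

/-- The representation of the symmetric group on `n` letters induced from the conjugation
action of the alternating group on itself. -/
def inducedConjAlternating (n : ℕ) :
    Representation ℂ (Equiv.Perm (Fin n))
      (Representation.IndV (alternatingGroup (Fin n)).subtype
        (conjRep (alternatingGroup (Fin n)))) :=
  Representation.ind (alternatingGroup (Fin n)).subtype (conjRep (alternatingGroup (Fin n)))

namespace SymmFun

/-! Symmetric functions over `ℂ` are written as formal power series in countably many
variables `x₀, x₁, …`, given through their coefficients. -/

open Classical in
/-- The power sum `p_k = ∑ᵢ xᵢ ^ k` (for `k ≥ 1`). -/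
def p (k : ℕ) : MvPowerSeries ℕ ℂ :=
  fun m => if ∃ i, m = Finsupp.single i k then 1 else 0

/-- `p_μ = ∏ᵢ p_{μᵢ}`, the product over all the parts of `μ`, with multiplicity. -/
def pPart {n : ℕ} (μ : n.Partition) : MvPowerSeries ℕ ℂ :=
  (μ.parts.map p).prod

/-- The complete homogeneous symmetric function `h_k`, the sum of all monomials of degree `k`. -/
def h (k : ℕ) : MvPowerSeries ℕ ℂ :=
  fun m => if m.degree = k then 1 else 0

open Classical in
/-- The elementary symmetric function `e_k`, the sum of all squarefree monomials of degree `k`. -/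
def e (k : ℕ) : MvPowerSeries ℕ ℂ :=
  fun m => if m.degree = k ∧ ∀ i, m i ≤ 1 then 1 else 0

/-- The Frobenius characteristic of a (finite-dimensional) representation `ρ` of the symmetric
group, `ch ρ = (1 / n!) ∑_σ χ(σ) p_{type σ}` with `χ` the character of `ρ`. Collecting the
permutations of the same cycle type, this is `∑_{μ ⊢ n} z_μ⁻¹ χ(μ) p_μ`. -/
def ch {n : ℕ} {V : Type*} [AddCommGroup V] [Module ℂ V]
    (ρ : Representation ℂ (Equiv.Perm (Fin n)) V) : MvPowerSeries ℕ ℂ :=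
  ((n.factorial : ℂ)⁻¹) • ∑ σ : Equiv.Perm (Fin n), ρ.character σ • pPart σ.partition

end SymmFun

end

/-! The conjugation action of `A_n` on itself is the restriction of the action of `S_n` on `A_n`.
Inducing it therefore amounts to tensoring `ψ(S_n, A_n)` with the representation on the two cosets
of `A_n`, which is `1 ⊕ sgn` for `n ≥ 2`. This gives self-conjugacy, the decomposition and the
degree. It also gives the character `(1 + sgn σ) |C(σ) ∩ A_n|`. The group `C(σ) ∩ A_n` is all of the
centralizer `C(σ)` exactly when the cycle type lies in `DO_n`, and otherwise has index two. Since
class size times centralizer order is `n!`, the Frobenius characteristic follows, and degree 3 is a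
comparison of coefficients.

The hard part is the occurrence of every irreducible `V`. By reciprocity it suffices to find an even
`g` and a nonzero vector of `V` fixed by all even permutations commuting with `g`
(`exists_fixedByEvenCentralizer`, used through `exists_conjSum_ne_zero`). Such a `g` is built by
induction on `n` from odd cycles of distinct lengths. If `c` is an odd cycle with a nonzero fixed
vector, the permutations of the remaining letters act on the vectors fixed by `c`. A solution `h`
there without cycles of the length of `c` yields the solution `c h`
(`FixedByEvenCentralizer.mul_ofSubtype`). Bertrand's postulate provides a prime `p` with `n/2 < p <
n` as the length of `c`. The remainder 3, where the induction fails, is treated with a 3-cycle and a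
cycle of length `p` or `p - 2`.

Fixed vectors of `p`-cycles come from Jucys–Murphy elements in the manner of Okounkov and Vershik.
If no `p`-cycle fixes a nonzero vector, then `1 + σ + ⋯ + σ^(p-1)` vanishes for each of them.
Summing over all `p`-cycles shows that their class sum acts as `-(p-2)!`. On a joint eigenvector
this sum is the product of the eigenvalues (contents) after the first. The product is nonzero, so
the contents are those of a hook. In degree greater than `p` this is contradictory; in degree `p` it
leaves only hooks with arm or leg of length one, on which a `(p-2)`-cycle has a fixed vector. -/

noncomputable section

/-! ### Combinatorics of content sequences and hooks. -/

/-- The combinatorial properties shared by the sets of joint eigenvalues (“weights”) of the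
Jucys–Murphy elements `J₀, …, J_{N-1}` on representations of symmetric groups. -/
structure IsWeightSet (N : ℕ) (A : Set (ℕ → ℂ)) : Prop where
  zero : ∀ a ∈ A, a 0 = 0
  ne : ∀ a ∈ A, ∀ i, i + 1 < N → a i ≠ a (i + 1)
  swap : ∀ a ∈ A, ∀ i, i + 1 < N → a (i + 1) ≠ a i + 1 → a (i + 1) ≠ a i - 1 →
    a ∘ Equiv.swap i (i + 1) ∈ A
  braid : ∀ a ∈ A, ∀ i, i + 2 < N → (a (i + 1) = a i + 1 ∨ a (i + 1) = a i - 1) →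
    a (i + 2) ≠ a i

/-- The prefix `a₀, …, a_i` is a shuffle of `0`, `1, …, r` and `-1, …, -s`. -/
inductive HookPrefix (a : ℕ → ℂ) : ℕ → ℕ → ℕ → Prop
  | zero : a 0 = 0 → HookPrefix a 0 0 0
  | pos {i r s : ℕ} : HookPrefix a i r s → a (i + 1) = r + 1 → HookPrefix a (i + 1) (r + 1) s
  | neg {i r s : ℕ} : HookPrefix a i r s → a (i + 1) = -(s + 1) → HookPrefix a (i + 1) r (s + 1)

namespace HookPrefix

variable {a b : ℕ → ℂ} {i r s r' s' : ℕ}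

theorem add_eq (h : HookPrefix a i r s) : r + s = i := by
  induction h with
  | zero => rfl
  | pos _ _ ih => omega
  | neg _ _ ih => omega

theorem congr (h : HookPrefix a i r s) (hab : ∀ l ≤ i, b l = a l) : HookPrefix b i r s := by
  induction h with
  | zero h => exact .zero (by rw [hab 0 le_rfl, h])
  | pos _ h ih => exact .pos (ih fun l hl => hab l (by omega)) (by rw [hab _ le_rfl, h])
  | neg _ h ih => exact .neg (ih fun l hl => hab l (by omega)) (by rw [hab _ le_rfl, h])

theorem flip (h : HookPrefix a i r s) : HookPrefix (-a) i s r := by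
  induction h with
  | zero h => exact .zero (by simp [h])
  | pos _ h ih => exact .neg ih (by simp [h])
  | neg _ h ih => exact .pos ih (by simp [h])

theorem natCast_add_one_ne_neg (r s : ℕ) : (r : ℂ) + 1 ≠ -(s + 1) := by
  intro h
  have h2 : ((r + 1 + s + 1 : ℕ) : ℂ) = 0 := by push_cast; linear_combination h
  exact absurd (Nat.cast_eq_zero.mp h2) (by omega)

theorem unique (h : HookPrefix a i r s) (h' : HookPrefix a i r' s') : r = r' ∧ s = s' := by
  induction h generalizing r' s' with
  | zero => cases h'; simp
  | pos _ h ih =>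
    cases h' with
    | pos k' h' => obtain ⟨rfl, rfl⟩ := ih k'; simp
    | neg k' h' => exact absurd (h.symm.trans h') (natCast_add_one_ne_neg _ _)
  | neg _ h ih =>
    cases h' with
    | neg k' h' => obtain ⟨rfl, rfl⟩ := ih k'; simp
    | pos k' h' => exact absurd (h'.symm.trans h) (natCast_add_one_ne_neg _ _)

theorem next (h : HookPrefix a i r s) (h' : HookPrefix a (i + 1) r' s') :
    a (i + 1) = r + 1 ∨ a (i + 1) = -(s + 1) := by
  cases h' with
  | pos k' e => obtain ⟨rfl, rfl⟩ := h.unique k'; exact .inl e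
  | neg k' e => obtain ⟨rfl, rfl⟩ := h.unique k'; exact .inr e

/-- The contents of a hook other than the corner are `1, …, r` and `-1, …, -s`, once each. -/
theorem prod_eq (h : HookPrefix a i r s) :
    ∏ l ∈ Finset.Ico 1 (i + 1), a l = (-1) ^ s * (r.factorial * s.factorial) := by
  induction h with
  | zero => simp
  | pos _ h ih =>
    rw [Finset.prod_Ico_succ_top (by omega), ih, h, Nat.factorial_succ]; push_cast; ring
  | neg _ h ih =>
    rw [Finset.prod_Ico_succ_top (by omega), ih, h, Nat.factorial_succ]; push_cast; ring

theorem apply_of_zero (h : HookPrefix a i r s) (hs : s = 0) : ∀ l ≤ i, a l = l := by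
  induction h with
  | zero h => intro l hl; obtain rfl : l = 0 := by omega
              simp [h]
  | @pos i r s k h ih =>
    intro l hl
    rcases Nat.lt_or_ge l (i + 1) with h1 | h1
    · exact ih hs l (by omega)
    · obtain rfl : l = i + 1 := le_antisymm hl h1
      have := k.add_eq
      rw [h]; subst hs; push_cast [← this]; simp
  | neg => omega

/-- The last negative entry of a hook prefix. -/
theorem exists_last_neg (h : HookPrefix a i r s) (hs : 1 ≤ s) :
    ∃ j ≤ i, 1 ≤ j ∧ a j = -s ∧ (∀ l, j < l → l ≤ i → ∃ t : ℕ, 1 ≤ t ∧ a l = t) ∧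
      ∃ r', HookPrefix a (j - 1) r' (s - 1) ∧ ∀ l, j < l → l ≤ i → a l = r' + (l - j : ℕ) := by
  induction h with
  | zero => omega
  | @pos i r s k h ih =>
    obtain ⟨j, hj, hj1, hja, hl, r', hr', hl'⟩ := ih hs
    have hr : (r' : ℕ) + (i - j) = r := by
      have := hr'.add_eq; have := k.add_eq; omega
    refine ⟨j, by omega, hj1, hja, fun l h1 h2 => ?_, r', hr', fun l h1 h2 => ?_⟩
    · rcases Nat.lt_or_ge l (i + 1) with h3 | h3
      · exact hl l h1 (by omega)
      · obtain rfl : l = i + 1 := by omega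
        exact ⟨r + 1, by omega, by rw [h]; push_cast; rfl⟩
    · rcases Nat.lt_or_ge l (i + 1) with h3 | h3
      · exact hl' l h1 (by omega)
      · obtain rfl : l = i + 1 := by omega
        rw [h, ← hr, show i + 1 - j = (i - j) + 1 by omega]; push_cast; ring
  | @neg i r s k h ih =>
    refine ⟨i + 1, le_rfl, by omega, by rw [h]; push_cast; rfl, fun l h1 h2 => by omega, r, ?_,
      fun l h1 h2 => by omega⟩
    simpa using k

end HookPrefix

namespace IsWeightSet

variable {N p : ℕ} {A : Set (ℕ → ℂ)} {a : ℕ → ℂ}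

/-- Negating contents corresponds to transposing diagrams; this symmetry lets arm and leg share one
argument. -/
theorem flip (hA : IsWeightSet N A) : IsWeightSet N {a | -a ∈ A} where
  zero a ha := by simpa using hA.zero _ ha
  ne a ha i hi h := hA.ne _ ha i hi (by simp [h])
  swap a ha i hi h1 h2 := hA.swap _ ha i hi
    (fun h => h2 (by simp only [Pi.neg_apply] at h; linear_combination -h))
    (fun h => h1 (by simp only [Pi.neg_apply] at h; linear_combination -h))
  braid a ha i hi h h' := hA.braid _ ha i hi
    (h.symm.imp (fun h => by simp only [Pi.neg_apply]; linear_combination -h)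
      (fun h => by simp only [Pi.neg_apply]; linear_combination -h)) (by simp [h'])

theorem mono (hA : IsWeightSet N A) {M : ℕ} (h : M ≤ N) : IsWeightSet M A where
  zero := hA.zero
  ne a ha i hi := hA.ne a ha i (by omega)
  swap a ha i hi := hA.swap a ha i (by omega)
  braid a ha i hi := hA.braid a ha i (by omega)

/-- In terms of diagrams, a second `0` would be the box outside the hook diagonal to the corner.
Without it, each new box prolongs the arm or the leg. -/
theorem hookPrefix_succ_of_pos (hA : IsWeightSet N A) (hnz : ∀ a ∈ A, ∀ i, 0 < i → i < N → a i ≠ 0)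
    {i r s : ℕ} (hi : i + 2 < N)
    (ih : ∀ b ∈ A, ∃ r s, HookPrefix b (i + 1) r s) (ha : a ∈ A) (k : HookPrefix a i r s)
    (h : a (i + 1) = r + 1) : ∃ r s, HookPrefix a (i + 2) r s := by
  have k1 := HookPrefix.pos k h
  by_cases h1 : a (i + 2) = a (i + 1) + 1
  · exact ⟨_, _, .pos k1 (by rw [h1, h]; push_cast; rfl)⟩
  by_cases h2 : a (i + 2) = a (i + 1) - 1
  · exfalso
    rw [h, add_sub_cancel_right] at h2
    cases k with
    | zero h0 => exact hnz a ha _ (by omega) hi (by simpa using h2)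
    | pos k' h' =>
      exact hA.braid a ha _ hi (.inl (by rw [h, h']; push_cast; ring)) (by rw [h2, h']; push_cast; ring)
    -- The entry `-(s + 1)` is moved to the right past `r + 1` and `r`. The impossible pair `r + 1,
    -- r` then sits one place earlier, where `ih` excludes it.
    | @neg i r s k' h' =>
      have hr : r ≠ 0 := fun hr => hnz a ha _ (by omega) hi (by simpa [hr] using h2)
      have hb := hA.swap a ha (i + 1) (by omega) (fun e => ?_) (fun e => ?_)
      rotate_left
      · rw [h, h'] at e
        exact HookPrefix.natCast_add_one_ne_neg r s (by
          exfalso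
          have h2 : ((r + 1 + s : ℕ) : ℂ) = 0 := by push_cast; linear_combination e
          exact absurd (Nat.cast_eq_zero.mp h2) (by omega))
      · rw [h, h'] at e
        have h2 : ((r + 1 + s + 2 : ℕ) : ℂ) = 0 := by push_cast; linear_combination e
        exact absurd (Nat.cast_eq_zero.mp h2) (by omega)
      set b := a ∘ Equiv.swap (i + 1) (i + 1 + 1) with hbdef
      have b1 : b (i + 1) = r + 1 := by simp [hbdef, h]
      have b2 : b (i + 2) = -(s + 1) := by simp [hbdef, h']
      have b3 : b (i + 3) = r := by
        rw [hbdef, Function.comp, Equiv.swap_apply_of_ne_of_ne (by omega) (by omega)]; exact h2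
      have hd := hA.swap b hb (i + 2) (by omega) (fun e => ?_) (fun e => ?_)
      rotate_left
      · rw [b2, b3] at e
        have h2 : ((r + s : ℕ) : ℂ) = 0 := by push_cast; linear_combination e
        exact absurd (Nat.cast_eq_zero.mp h2) (by omega)
      · rw [b2, b3] at e
        have h2 : ((r + s + 2 : ℕ) : ℂ) = 0 := by push_cast; linear_combination e
        exact absurd (Nat.cast_eq_zero.mp h2) (by omega)
      set d := b ∘ Equiv.swap (i + 2) (i + 2 + 1) with hddef
      have d1 : d (i + 1) = r + 1 := by
        rw [hddef, Function.comp, Equiv.swap_apply_of_ne_of_ne (by omega) (by omega), b1]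
      have d2 : d (i + 2) = r := by simp [hddef, b3]
      have kd : HookPrefix d (i + 1) (r + 1) s := by
        refine .pos (k'.congr fun l hl => ?_) d1
        rw [hddef, Function.comp, Equiv.swap_apply_of_ne_of_ne (by omega) (by omega), hbdef,
          Function.comp, Equiv.swap_apply_of_ne_of_ne (by omega) (by omega)]
      obtain ⟨r', s', k''⟩ := ih d hd
      rcases kd.next k'' with e | e
      · rw [d2] at e
        have h2 : ((2 : ℕ) : ℂ) = 0 := by push_cast at e ⊢; linear_combination -e
        exact absurd (Nat.cast_eq_zero.mp h2) (by omega)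
      · rw [d2] at e
        have h2 : ((r + s + 1 : ℕ) : ℂ) = 0 := by push_cast at e ⊢; linear_combination e
        exact absurd (Nat.cast_eq_zero.mp h2) (by omega)
  -- After the swap, `a (i + 2)` directly follows the prefix of type `(r, s)`, so it is `r + 1` or
  -- `-(s + 1)`; the former equals its neighbour.
  · have hb := hA.swap a ha (i + 1) hi h1 h2
    obtain ⟨r', s', k'⟩ := ih _ hb
    have kb : HookPrefix (a ∘ Equiv.swap (i + 1) (i + 1 + 1)) i r s := k.congr fun l hl => by
      rw [Function.comp, Equiv.swap_apply_of_ne_of_ne (by omega) (by omega)]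
    rcases kb.next k' with e | e
    · simp only [Function.comp, Equiv.swap_apply_left] at e
      exact absurd (h.trans e.symm) (hA.ne a ha _ hi)
    · simp only [Function.comp, Equiv.swap_apply_left] at e
      exact ⟨_, _, .neg k1 e⟩

theorem exists_hookPrefix (hA : IsWeightSet N A)
    (hnz : ∀ a ∈ A, ∀ i, 0 < i → i < N → a i ≠ 0) :
    ∀ i < N, ∀ a ∈ A, ∃ r s, HookPrefix a i r s := by
  intro i
  induction i with
  | zero => exact fun _ a ha => ⟨0, 0, .zero (hA.zero a ha)⟩
  | succ i ih =>
    intro hi a ha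
    obtain ⟨r, s, k⟩ := ih (by omega) a ha
    cases k with
    | zero h0 =>
      by_cases h1 : a 1 = a 0 + 1
      · exact ⟨_, _, .pos (.zero h0) (by rw [zero_add, h1, h0]; simp)⟩
      by_cases h2 : a 1 = a 0 - 1
      · exact ⟨_, _, .neg (.zero h0) (by rw [zero_add, h2, h0]; simp)⟩
      -- A value other than `±1` in position 1 could be swapped into position 0, hence would be `0`
      -- and equal its neighbour.
      have := hA.zero _ (hA.swap a ha 0 hi h1 h2)
      simp only [zero_add, Function.comp, Equiv.swap_apply_left] at this
      exact absurd (h0.trans this.symm) (hA.ne a ha 0 hi)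
    | pos k h => exact hA.hookPrefix_succ_of_pos hnz hi (ih (by omega)) ha k h
    | neg k h =>
      obtain ⟨r', s', k'⟩ := hA.flip.hookPrefix_succ_of_pos (a := -a)
        (fun b hb i h1 h2 h3 => hnz _ hb i h1 h2 (by simp [h3])) hi
        (fun b hb => by
          obtain ⟨r', s', k'⟩ := ih (by omega) _ hb
          exact ⟨s', r', by simpa using k'.flip⟩) (by simpa using ha) k.flip (by simp [h])
      exact ⟨s', r', by simpa using k'.flip⟩

/-- A negative entry followed by positive ones can be moved to the right. -/
theorem exists_move (hA : IsWeightSet N A) (hp : p < N) {s : ℕ} (hs : 1 ≤ s) (d : ℕ) :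
    ∀ j, j + d = p → ∀ a ∈ A, a j = -s → (∀ l, j < l → l ≤ p → ∃ t : ℕ, 1 ≤ t ∧ a l = t) →
      ∃ b ∈ A, b p = -s ∧ (∀ l, p < l → b l = a l) ∧ (∀ l < j, b l = a l) ∧
        ∀ l, j ≤ l → l < p → b l = a (l + 1) := by
  induction d with
  | zero =>
    intro j hj a ha h1 h2
    obtain rfl : j = p := hj
    exact ⟨a, ha, h1, fun _ _ => rfl, fun _ _ => rfl, fun l _ _ => by omega⟩
  | succ d ih =>
    intro j hj a ha h1 h2
    obtain ⟨t, ht, hat⟩ := h2 (j + 1) (by omega) (by omega)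
    have hb := hA.swap a ha j (by omega) (fun e => ?_) (fun e => ?_)
    rotate_left
    · rw [hat, h1] at e
      have h2 : ((t + s : ℕ) : ℂ) = (1 : ℕ) := by push_cast; linear_combination e
      exact absurd (Nat.cast_injective h2) (by omega)
    · rw [hat, h1] at e
      have h2 : ((t + s + 1 : ℕ) : ℂ) = 0 := by push_cast; linear_combination e
      exact absurd (Nat.cast_eq_zero.mp h2) (by omega)
    have hbl : ∀ l, l ≠ j → l ≠ j + 1 → (a ∘ Equiv.swap j (j + 1)) l = a l := fun l h3 h4 => by
      rw [Function.comp, Equiv.swap_apply_of_ne_of_ne h3 h4]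
    obtain ⟨c, hc, c1, c2, c3, c4⟩ := ih (j + 1) (by omega) _ hb (by simp [h1])
      (fun l h3 h4 => by rw [hbl l (by omega) (by omega)]; exact h2 l (by omega) h4)
    refine ⟨c, hc, c1, fun l hl => ?_, fun l hl => ?_, fun l hl hl' => ?_⟩
    · rw [c2 l hl, hbl l (by omega) (by omega)]
    · rw [c3 l (by omega), hbl l (by omega) (by omega)]
    · rcases hl.eq_or_lt with rfl | h3
      · rw [c3 _ (by omega)]; simp
      · rw [c4 l h3 hl', hbl _ (by omega) (by omega)]

/-- A hook with `p` boxes, arm and leg both nonempty, can be filled so that the last box ends the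
arm or ends the leg. The entry `a p` would have to be adjacent to the content of either end, but
these contents are `p - 1 ≥ 3` apart. -/
theorem false_of_pos {κ : ℂ} (hA : IsWeightSet (p + 1) A) (hp : 4 ≤ p) (hκ0 : κ ≠ 0)
    (hκ : κ ≠ (p - 1).factorial)
    (hprod : ∀ a ∈ A, ∏ l ∈ Finset.Ico 1 p, a l = κ) (ha : a ∈ A) {r s : ℕ}
    (k : HookPrefix a (p - 1) (r + 1) s) (hr : a (p - 1) = r + 1) : False := by
  -- Otherwise positions `p - 1` and `p` could be swapped. This alters only the last factor of a
  -- product that is constant on `A`, so the two entries would be equal.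
  have last : ∀ b ∈ A, b p = b (p - 1) + 1 ∨ b p = b (p - 1) - 1 := by
    intro b hb
    by_contra! hne
    have hp1 : p - 1 + 1 = p := by omega
    have hc := hA.swap b hb (p - 1) (by omega) (by rw [hp1]; exact hne.1) (by rw [hp1]; exact hne.2)
    have e1 := hprod _ hb
    have e2 := hprod _ hc
    have split : ∀ f : ℕ → ℂ, ∏ l ∈ Finset.Ico 1 p, f l =
        (∏ l ∈ Finset.Ico 1 (p - 1), f l) * f (p - 1) := fun f => by
      rw [← Finset.prod_Ico_succ_top (by omega), hp1]
    rw [split] at e1 e2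
    have e3 : ∏ l ∈ Finset.Ico 1 (p - 1), (b ∘ Equiv.swap (p - 1) (p - 1 + 1)) l =
        ∏ l ∈ Finset.Ico 1 (p - 1), b l := Finset.prod_congr rfl fun l hl => by
      rw [Finset.mem_Ico] at hl
      rw [Function.comp, Equiv.swap_apply_of_ne_of_ne (by omega) (by omega)]
    rw [e3] at e2
    simp only [Function.comp, Equiv.swap_apply_left] at e2
    have h0 : ∏ l ∈ Finset.Ico 1 (p - 1), b l ≠ 0 := fun h => hκ0 (by rw [← e1, h, zero_mul])
    exact hA.ne b hb (p - 1) (by omega) (mul_left_cancel₀ h0 (e1.trans e2.symm))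
  have hsum := k.add_eq
  have hs : s ≠ 0 := by
    rintro rfl
    apply hκ
    have := k.prod_eq
    rw [show p - 1 + 1 = p by omega, hprod a ha] at this
    rw [this, ← hsum]; simp
  obtain ⟨j, hj, hj1, hja, hpos, -⟩ := k.exists_last_neg (by omega)
  obtain ⟨b, hb, b1, b2, -, -⟩ := hA.exists_move (p := p - 1) (by omega) (s := s) (by omega)
    (p - 1 - j) j (by omega) a ha hja hpos
  have l1 := last a ha
  have l2 := last b hb
  rw [b1, b2 p (by omega)] at l2
  rw [hr] at l1
  have : r + s < 2 := by
    rcases l1 with l1 | l1 <;> rcases l2 with l2 | l2 <;> rw [l1] at l2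
    · have h2 : ((r + 1 + s : ℕ) : ℂ) = 0 := by push_cast; linear_combination l2
      exact absurd (Nat.cast_eq_zero.mp h2) (by omega)
    · have h2 : ((r + s + 3 : ℕ) : ℂ) = 0 := by push_cast; linear_combination l2
      exact absurd (Nat.cast_eq_zero.mp h2) (by omega)
    · have h2 : ((r + s : ℕ) : ℂ) = (1 : ℕ) := by push_cast; linear_combination l2
      have := Nat.cast_injective h2; omega
    · have h2 : ((r + s + 1 : ℕ) : ℂ) = 0 := by push_cast; linear_combination l2
      exact absurd (Nat.cast_eq_zero.mp h2) (by omega)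
  omega

theorem ne_zero_of_prod {κ : ℂ} (hκ0 : κ ≠ 0)
    (hprod : ∀ a ∈ A, ∏ l ∈ Finset.Ico 1 p, a l = κ) :
    ∀ a ∈ A, ∀ i, 0 < i → i < p → a i ≠ 0 := fun a ha i h1 h2 h3 =>
  hκ0 (by rw [← hprod a ha]; exact Finset.prod_eq_zero (Finset.mem_Ico.mpr ⟨h1, h2⟩) h3)

/-- As `p - 1` is even, negation preserves the product, so the case of a last box in the leg follows
by `flip`. -/
theorem notMem_of_prod {κ : ℂ} (hA : IsWeightSet (p + 1) A) (hp : 4 ≤ p) (hodd : Odd p)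
    (hκ0 : κ ≠ 0) (hκ : κ ≠ (p - 1).factorial)
    (hprod : ∀ a ∈ A, ∏ l ∈ Finset.Ico 1 p, a l = κ) (a : ℕ → ℂ) : a ∉ A := by
  intro ha
  have hnz := ne_zero_of_prod hκ0 hprod
  obtain ⟨r, s, k⟩ := (hA.mono p.le_succ).exists_hookPrefix hnz (p - 1) (by omega) a ha
  obtain ⟨q, hq⟩ : ∃ q, p - 1 = q + 1 := ⟨p - 2, by omega⟩
  have hprod' : ∀ b ∈ {a | -a ∈ A}, ∏ l ∈ Finset.Ico 1 p, b l = κ := fun b hb => by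
    rw [← hprod _ hb]
    simp only [Pi.neg_apply, Finset.prod_neg, Nat.card_Ico]
    rw [Even.neg_one_pow (by obtain ⟨m, hm⟩ := hodd; exact ⟨m, by omega⟩), one_mul]
  have k' := k
  rw [hq] at k
  cases k with
  | pos k0 h => exact hA.false_of_pos hp hκ0 hκ hprod ha k' (by rw [hq, h])
  | neg k0 h =>
    exact hA.flip.false_of_pos hp hκ0 hκ hprod' (a := -a) (by simpa using ha) k'.flip
      (by rw [hq]; simp [h])

/-- With `r = m + 1`: `r! ≤ (m + 1)^m < (s + 1)^m`, while `s! (s + 1)^m ≤ (s + m)!`. -/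
theorem _root_.Nat.factorial_mul_factorial_lt {r s : ℕ} (hr : 2 ≤ r) (h : r ≤ s) :
    r.factorial * s.factorial < (r + s - 1).factorial := by
  obtain ⟨m, rfl⟩ : ∃ m, r = m + 1 := ⟨r - 1, by omega⟩
  have h1 : (m + 1).factorial ≤ (m + 1) ^ m := by
    clear hr h
    induction m with
    | zero => simp
    | succ m ih =>
      rw [Nat.factorial_succ, pow_succ, mul_comm]
      exact Nat.mul_le_mul_right _ (ih.trans (Nat.pow_le_pow_left (by omega) _))
  have h2 : (m + 1) ^ m < (s + 1) ^ m := Nat.pow_lt_pow_left (by omega) (by omega)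
  have h3 := Nat.factorial_mul_pow_le_factorial (m := s) (n := m)
  rw [show m + 1 + s - 1 = s + m by omega, mul_comm]
  exact (Nat.mul_lt_mul_of_pos_left (h1.trans_lt h2) s.factorial_pos).trans_le h3

/-- The only negative entry is `-1`; moved to the end, it leaves `0, 1, …, p - 2` in front. -/
theorem exists_straight_of_one (hA : IsWeightSet p A) (hp : 4 ≤ p) (ha : a ∈ A) {r : ℕ}
    (k : HookPrefix a (p - 1) r 1) : ∃ b ∈ A, ∀ i < p - 1, b i = i := by
  obtain ⟨j, hj, hj1, hja, hpos, r', hr', hl⟩ := k.exists_last_neg le_rfl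
  obtain ⟨b, hb, b1, b2, b3, b4⟩ := hA.exists_move (p := p - 1) (by omega) (s := 1) le_rfl
    (p - 1 - j) j (by omega) a ha hja hpos
  refine ⟨b, hb, fun i hi => ?_⟩
  have := hr'.add_eq
  rcases Nat.lt_or_ge i j with h | h
  · rw [b3 i h, hr'.apply_of_zero rfl i (by omega)]
  · rw [b4 i h hi, hl _ (by omega) (by omega), ← Nat.cast_add]
    congr 1; omega

/-- Taking absolute values, `r! s! = (p - 2)!` with `r + s = p - 1`, which forces `r = 1` or `s =
1`. -/
theorem exists_straight (hA : IsWeightSet p A) (hp : 4 ≤ p)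
    (hprod : ∀ a ∈ A, ∏ l ∈ Finset.Ico 1 p, a l = -((p - 2).factorial : ℂ)) (ha : a ∈ A) :
    ∃ b ∈ A, (∀ i < p - 1, b i = i) ∨ (∀ i < p - 1, b i = -i) := by
  have hκ0 : -((p - 2).factorial : ℂ) ≠ 0 :=
    neg_ne_zero.mpr (Nat.cast_ne_zero.mpr (Nat.factorial_ne_zero _))
  obtain ⟨r, s, k⟩ := hA.exists_hookPrefix (ne_zero_of_prod hκ0 hprod) (p - 1) (by omega) a ha
  have hsum := k.add_eq
  have hpr := k.prod_eq
  rw [show p - 1 + 1 = p by omega, hprod a ha] at hpr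
  have hf : (r.factorial * s.factorial) = (r + s - 1).factorial := by
    have h := congrArg norm hpr
    rw [show p - 2 = r + s - 1 by omega, ← Nat.cast_mul] at h
    simpa [-Nat.cast_mul] using h.symm
  by_cases hs1 : s = 1
  · subst hs1
    obtain ⟨b, hb, h⟩ := hA.exists_straight_of_one hp ha k
    exact ⟨b, hb, .inl h⟩
  by_cases hr1 : r = 1
  · subst hr1
    obtain ⟨b, hb, h⟩ := hA.flip.exists_straight_of_one hp (a := -a) (by simpa using ha) k.flip
    exact ⟨-b, hb, .inr fun i hi => by simp [h i hi]⟩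
  exfalso
  have key : ∀ m, 3 ≤ m → m.factorial ≠ (m - 1).factorial := fun m hm h => by
    obtain ⟨q, rfl⟩ : ∃ q, m = q + 1 := ⟨m - 1, by omega⟩
    rw [Nat.factorial_succ, Nat.add_sub_cancel] at h
    have := q.factorial_pos
    nlinarith
  rcases Nat.eq_zero_or_pos r with rfl | h
  · exact key s (by omega) (by simpa using hf)
  rcases Nat.eq_zero_or_pos s with rfl | h'
  · exact key r (by omega) (by simpa using hf)
  rcases le_total r s with h2 | h2
  · exact (Nat.factorial_mul_factorial_lt (by omega) h2).ne hf
  · exact (Nat.factorial_mul_factorial_lt (by omega) h2).ne (by rw [mul_comm, hf, add_comm])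

end IsWeightSet
end
-- Jucys–Murphy operators and their joint eigenvectors.
noncomputable section

open Equiv (swap)

section JucysMurphy

variable {α V : Type*} [DecidableEq α] [AddCommGroup V] [Module ℂ V]
  (ρ : Representation ℂ (Equiv.Perm α) V) (e : ℕ → α) {N : ℕ}

/-- The action of the Jucys–Murphy element `J_j = ∑_{i < j} (e i  e j)`. -/
def jucysMurphy (j : ℕ) : V →ₗ[ℂ] V := ∑ i ∈ Finset.range j, ρ (swap (e i) (e j))

variable {e}

theorem jucysMurphy_eq_sum_image (he : Set.InjOn e (Set.Iio N)) {j : ℕ} (hj : j < N) :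
    jucysMurphy ρ e j = ∑ x ∈ (Finset.range j).image e, ρ (swap x (e j)) := by
  rw [jucysMurphy, Finset.sum_image]
  intro a ha b hb h
  have ha' := Finset.mem_range.mp (Finset.mem_coe.mp ha)
  have hb' := Finset.mem_range.mp (Finset.mem_coe.mp hb)
  exact he (ha'.trans hj) (hb'.trans hj) h

variable {ρ}

/-- Conjugation by a transposition of earlier letters permutes the summands of `J_j`. -/
theorem swap_jucysMurphy_apply_of_lt (he : Set.InjOn e (Set.Iio N)) {a b j : ℕ} (ha : a < j)
    (hb : b < j) (hj : j < N) (v : V) :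
    ρ (swap (e a) (e b)) (jucysMurphy ρ e j v) = jucysMurphy ρ e j (ρ (swap (e a) (e b)) v) := by
  have hne : ∀ i < j, e i ≠ e j := fun i hi h => hi.ne (he (hi.trans hj) hj h)
  rw [jucysMurphy_eq_sum_image ρ he hj, LinearMap.sum_apply, LinearMap.sum_apply, map_sum]
  have mem : ∀ i < j, e i ∈ (Finset.range j).image e := fun i hi =>
    Finset.mem_image_of_mem _ (Finset.mem_range.mpr hi)
  refine Finset.sum_equiv (swap (e a) (e b)) (fun x => ?_) fun x _ => ?_
  · have key : ∀ y ∈ (Finset.range j).image e, swap (e a) (e b) y ∈ (Finset.range j).image e := by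
      intro y hy
      rw [Equiv.swap_apply_def]
      split_ifs
      exacts [mem b hb, mem a ha, hy]
    exact ⟨key x, fun h => by simpa using key _ h⟩
  · rw [← Module.End.mul_apply, ← Module.End.mul_apply, ← map_mul, ← map_mul,
      Equiv.mul_swap_eq_swap_mul, Equiv.swap_apply_of_ne_of_ne (hne a ha).symm (hne b hb).symm]

theorem jucysMurphy_comm (he : Set.InjOn e (Set.Iio N)) {i j : ℕ} (hi : i < N) (hj : j < N)
    (v : V) :
    jucysMurphy ρ e i (jucysMurphy ρ e j v) = jucysMurphy ρ e j (jucysMurphy ρ e i v) := by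
  wlog h : i ≤ j generalizing i j
  · exact (this hj hi (by omega)).symm
  rcases h.eq_or_lt with rfl | h
  · rfl
  rw [jucysMurphy, LinearMap.sum_apply, LinearMap.sum_apply, map_sum]
  exact Finset.sum_congr rfl fun a ha => swap_jucysMurphy_apply_of_lt he
    ((Finset.mem_range.mp ha).trans h) h hj v

theorem swap_jucysMurphy_apply_of_gt (he : Set.InjOn e (Set.Iio N)) {i j : ℕ} (hj : j < i)
    (hi : i + 1 < N) (v : V) :
    ρ (swap (e i) (e (i + 1))) (jucysMurphy ρ e j v) =
      jucysMurphy ρ e j (ρ (swap (e i) (e (i + 1))) v) := by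
  have hne : ∀ a < i, ∀ b, i ≤ b → b < N → e a ≠ e b := fun a ha b hb hb' h =>
    (ha.trans_le hb).ne (he ((ha.trans_le hb).trans hb') hb' h)
  rw [jucysMurphy, LinearMap.sum_apply, LinearMap.sum_apply, map_sum]
  refine Finset.sum_congr rfl fun a ha => ?_
  have ha := Finset.mem_range.mp ha
  rw [← Module.End.mul_apply, ← Module.End.mul_apply, ← map_mul, ← map_mul,
    Equiv.mul_swap_eq_swap_mul,
    Equiv.swap_apply_of_ne_of_ne (hne j hj _ le_rfl (by omega)) (hne j hj _ (by omega) hi),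
    Equiv.swap_apply_of_ne_of_ne (hne a (by omega) _ le_rfl (by omega))
      (hne a (by omega) _ (by omega) hi)]

theorem swap_apply_apply_self (x y : α) (v : V) : ρ (swap x y) (ρ (swap x y) v) = v := by
  rw [← Module.End.mul_apply, ← map_mul, Equiv.swap_mul_self, map_one, Module.End.one_apply]

/-- Conjugating the summands of `J_i` by the adjacent transposition gives all summands of `J_{i+1}`
except that transposition itself, which accounts for `- v`. -/
theorem swap_jucysMurphy_apply (he : Set.InjOn e (Set.Iio N)) {i : ℕ} (hi : i + 1 < N) (v : V) :
    ρ (swap (e i) (e (i + 1))) (jucysMurphy ρ e i v) =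
      jucysMurphy ρ e (i + 1) (ρ (swap (e i) (e (i + 1))) v) - v := by
  have hne : ∀ a < i, ∀ b, i ≤ b → b < N → e a ≠ e b := fun a ha b hb hb' h =>
    (ha.trans_le hb).ne (he ((ha.trans_le hb).trans hb') hb' h)
  rw [jucysMurphy, jucysMurphy, Finset.sum_range_succ, LinearMap.add_apply,
    swap_apply_apply_self, add_sub_cancel_right, LinearMap.sum_apply, LinearMap.sum_apply, map_sum]
  refine Finset.sum_congr rfl fun a ha => ?_
  have ha := Finset.mem_range.mp ha
  rw [← Module.End.mul_apply, ← Module.End.mul_apply, ← map_mul, ← map_mul,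
    Equiv.mul_swap_eq_swap_mul, Equiv.swap_apply_left,
    Equiv.swap_apply_of_ne_of_ne (hne a ha _ le_rfl (by omega)) (hne a ha _ (by omega) hi)]

variable (ρ e) in
/-- `v` is a joint eigenvector of the first `N` Jucys–Murphy elements with eigenvalues `a`. -/
def IsWeightVector (N : ℕ) (a : ℕ → ℂ) (v : V) : Prop :=
  v ≠ 0 ∧ ∀ j < N, jucysMurphy ρ e j v = a j • v

theorem exists_joint_eigenvector [FiniteDimensional ℂ V] [Nontrivial V] (f : ℕ → V →ₗ[ℂ] V)
    (N : ℕ) (hf : ∀ i < N, ∀ j < N, ∀ v, f i (f j v) = f j (f i v)) :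
    ∃ (a : ℕ → ℂ) (v : V), v ≠ 0 ∧ ∀ j < N, f j v = a j • v := by
  induction N with
  | zero =>
    obtain ⟨v, hv⟩ := exists_ne (0 : V)
    exact ⟨0, v, hv, by simp⟩
  | succ N ih =>
    obtain ⟨a, v, hv, h⟩ := ih fun i hi j hj => hf i (by omega) j (by omega)
    let W : Submodule ℂ V := ⨅ j : Fin N, LinearMap.ker (f j - a j • LinearMap.id)
    have memW : ∀ w, w ∈ W ↔ ∀ j < N, f j w = a j • w := fun w => by
      simp [W, Submodule.mem_iInf, sub_eq_zero, Fin.forall_iff]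
    have : Nontrivial W := ⟨⟨v, (memW v).mpr h⟩, 0, fun h0 => hv (congrArg Subtype.val h0)⟩
    have hW : ∀ w ∈ W, f N w ∈ W := fun w hw => (memW _).mpr fun j hj => by
      rw [hf j (by omega) N (by omega), (memW w).mp hw j hj, map_smul]
    obtain ⟨μ, hμ⟩ := Module.End.exists_eigenvalue ((f N).restrict hW)
    obtain ⟨w, hw⟩ := hμ.exists_hasEigenvector
    refine ⟨fun j => if j = N then μ else a j, w, fun h0 => hw.2 (Subtype.ext h0), fun j hj => ?_⟩
    rcases Nat.lt_succ_iff_lt_or_eq.mp hj with h1 | rfl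
    · simpa [h1.ne] using (memW _).mp w.2 j h1
    · simpa using congrArg Subtype.val hw.apply_eq_smul

theorem exists_isWeightVector [FiniteDimensional ℂ V] [Nontrivial V]
    (he : Set.InjOn e (Set.Iio N)) : ∃ a v, IsWeightVector ρ e N a v :=
  exists_joint_eigenvector _ N fun _ hi _ hj v => jucysMurphy_comm he hi hj v

end JucysMurphy

/-! ### Weights under an invariant inner product. -/

section Unitary

open scoped InnerProductSpace

variable {α V : Type*} [DecidableEq α] [NormedAddCommGroup V] [InnerProductSpace ℂ V]
  {ρ : Representation ℂ (Equiv.Perm α) V} {e : ℕ → α} {N : ℕ}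

theorem inner_swap_apply (hρ : ∀ g v w, ⟪ρ g v, ρ g w⟫_ℂ = ⟪v, w⟫_ℂ) (x y : α) (v w : V) :
    ⟪ρ (swap x y) v, w⟫_ℂ = ⟪v, ρ (swap x y) w⟫_ℂ := by
  rw [← hρ (swap x y), swap_apply_apply_self]

theorem inner_jucysMurphy (hρ : ∀ g v w, ⟪ρ g v, ρ g w⟫_ℂ = ⟪v, w⟫_ℂ) (j : ℕ) (v w : V) :
    ⟪jucysMurphy ρ e j v, w⟫_ℂ = ⟪v, jucysMurphy ρ e j w⟫_ℂ := by
  simp only [jucysMurphy, LinearMap.sum_apply, sum_inner, inner_sum, inner_swap_apply hρ]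

variable {a : ℕ → ℂ} {v : V}

namespace IsWeightVector

theorem conj_eq (hρ : ∀ g v w, ⟪ρ g v, ρ g w⟫_ℂ = ⟪v, w⟫_ℂ) (h : IsWeightVector ρ e N a v) {j : ℕ}
    (hj : j < N) : starRingEnd ℂ (a j) = a j := by
  have := inner_jucysMurphy (e := e) hρ j v v
  rw [h.2 j hj, inner_smul_left, inner_smul_right] at this
  exact mul_right_cancel₀ (inner_self_ne_zero.mpr h.1) this

/-- If the two eigenvalues agreed, `J_i` would act on `v` and its image under the transposition as a
nontrivial Jordan block, which is impossible for a self-adjoint operator. -/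
theorem ne_succ (hρ : ∀ g v w, ⟪ρ g v, ρ g w⟫_ℂ = ⟪v, w⟫_ℂ) (he : Set.InjOn e (Set.Iio N))
    (h : IsWeightVector ρ e N a v) {i : ℕ} (hi : i + 1 < N) : a i ≠ a (i + 1) := by
  intro hai
  have h1 := swap_jucysMurphy_apply (ρ := ρ) he hi (ρ (swap (e i) (e (i + 1))) v)
  rw [swap_apply_apply_self, h.2 _ hi] at h1
  have h2 := congrArg (fun w => ⟪ρ (swap (e i) (e (i + 1))) v, w⟫_ℂ) h1
  have h3 := inner_swap_apply hρ (e i) (e (i + 1)) v v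
  simp only [hρ, inner_sub_right, inner_smul_right] at h2
  rw [← inner_jucysMurphy hρ, h.2 i (by omega), inner_smul_left, h.conj_eq hρ (by omega), hai,
    h3] at h2
  exact h.1 (inner_self_eq_zero.mp (by linear_combination h2))

theorem jucysMurphy_swap (he : Set.InjOn e (Set.Iio N))
    (h : IsWeightVector ρ e N a v) {i : ℕ} (hi : i + 1 < N) :
    jucysMurphy ρ e i (ρ (swap (e i) (e (i + 1))) v) =
      a (i + 1) • ρ (swap (e i) (e (i + 1))) v - v := by
  have h1 := swap_jucysMurphy_apply (ρ := ρ) he hi (ρ (swap (e i) (e (i + 1))) v)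
  rw [swap_apply_apply_self, h.2 _ hi] at h1
  have h2 := congrArg (ρ (swap (e i) (e (i + 1)))) h1
  rwa [swap_apply_apply_self, map_sub, map_smul, swap_apply_apply_self] at h2

theorem jucysMurphy_succ_swap (he : Set.InjOn e (Set.Iio N))
    (h : IsWeightVector ρ e N a v) {i : ℕ} (hi : i + 1 < N) :
    jucysMurphy ρ e (i + 1) (ρ (swap (e i) (e (i + 1))) v) =
      a i • ρ (swap (e i) (e (i + 1))) v + v := by
  have h1 := swap_jucysMurphy_apply (ρ := ρ) he hi v
  rw [h.2 _ (by omega), map_smul] at h1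
  rw [h1, sub_add_cancel]

/-- On the span of `v` and its image under the transposition, `J_i` is triangular with eigenvalues
`a i` and `a (i + 1)`. The vector chosen is the eigenvector for the second one. -/
theorem swap_of_ne_zero (he : Set.InjOn e (Set.Iio N))
    (h : IsWeightVector ρ e N a v) {i : ℕ} (hi : i + 1 < N) (hd : a i ≠ a (i + 1))
    (hw : ρ (swap (e i) (e (i + 1))) v - (a (i + 1) - a i)⁻¹ • v ≠ 0) :
    IsWeightVector ρ e N (a ∘ swap i (i + 1))
      (ρ (swap (e i) (e (i + 1))) v - (a (i + 1) - a i)⁻¹ • v) := by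
  have hd' : a (i + 1) - a i ≠ 0 := sub_ne_zero.mpr hd.symm
  refine ⟨hw, fun j hj => ?_⟩
  rcases lt_trichotomy j i with h1 | rfl | h1
  · rw [map_sub, map_smul, ← swap_jucysMurphy_apply_of_gt he h1 hi, h.2 j hj, map_smul, smul_sub,
      Function.comp, Equiv.swap_apply_of_ne_of_ne (by omega) (by omega), smul_comm]
  · rw [map_sub, map_smul, h.jucysMurphy_swap he hi, h.2 j hj, Function.comp,
      Equiv.swap_apply_left]
    (match_scalars <;> field_simp); ring
  · rcases Nat.eq_or_lt_of_le h1 with rfl | h1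
    · rw [map_sub, map_smul, h.jucysMurphy_succ_swap he hi, h.2 _ hj, Function.comp,
        Equiv.swap_apply_right]
      (match_scalars <;> field_simp); ring
    · rw [map_sub, map_smul, ← swap_jucysMurphy_apply_of_lt he (by omega) h1 hj, h.2 j hj, map_smul,
        smul_sub, Function.comp, Equiv.swap_apply_of_ne_of_ne (by omega) (by omega), smul_comm]

/-- If the new vector vanished, the transposition would act on `v` by the inverse of the difference
of the two eigenvalues. This scalar has square 1, so the difference would be `±1`. -/
theorem swap_of_nonadjacent (he : Set.InjOn e (Set.Iio N))
    (h : IsWeightVector ρ e N a v) {i : ℕ} (hi : i + 1 < N) (hd : a i ≠ a (i + 1))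
    (h1 : a (i + 1) ≠ a i + 1) (h2 : a (i + 1) ≠ a i - 1) :
    ∃ w, IsWeightVector ρ e N (a ∘ swap i (i + 1)) w := by
  refine ⟨_, h.swap_of_ne_zero he hi hd fun h0 => ?_⟩
  have hd' : a (i + 1) - a i ≠ 0 := sub_ne_zero.mpr hd.symm
  rw [sub_eq_zero] at h0
  have h3 := swap_apply_apply_self (ρ := ρ) (e i) (e (i + 1)) v
  rw [h0, map_smul, h0, smul_smul] at h3
  have h4 : ((a (i + 1) - a i)⁻¹ * (a (i + 1) - a i)⁻¹ - 1) • v = 0 := by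
    rw [sub_smul, h3, one_smul, sub_self]
  have h5 := (smul_eq_zero.mp h4).resolve_right h.1
  field_simp at h5
  have h6 : (a (i + 1) - a i - 1) * (a (i + 1) - a i + 1) = 0 := by linear_combination -h5
  rcases mul_eq_zero.mp h6 with h6 | h6
  · exact h1 (by linear_combination h6)
  · exact h2 (by linear_combination h6)

/-- Adjacent eigenvalues differing by `±1`: the transposition acts by that scalar. -/
theorem swap_apply_eq (hρ : ∀ g v w, ⟪ρ g v, ρ g w⟫_ℂ = ⟪v, w⟫_ℂ) (he : Set.InjOn e (Set.Iio N))
    (h : IsWeightVector ρ e N a v) {i : ℕ} (hi : i + 1 < N) {d : ℂ} (hd : d * d = 1)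
    (had : a (i + 1) = a i + d) : ρ (swap (e i) (e (i + 1))) v = d • v := by
  have hd0 : d ≠ 0 := fun h0 => by simp [h0] at hd
  have hdi : (a (i + 1) - a i)⁻¹ = d := by
    rw [had, add_sub_cancel_left]; exact inv_eq_of_mul_eq_one_left hd
  have hne : a i ≠ a (i + 1) := fun h0 => hd0 (by linear_combination -h0 - had)
  by_contra hw
  have hww := h.swap_of_ne_zero he hi hne (by rw [hdi]; exact sub_ne_zero.mpr hw)
  rw [hdi] at hww
  set w := ρ (swap (e i) (e (i + 1))) v - d • v with hwdef
  -- The vectors `v` and `w` belong to different eigenvalues of the self-adjoint `J_i`. Since the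
  -- transposition maps `w` to `-d • w`, `w` is also orthogonal to the image of `v`, hence to
  -- itself.
  have o1 : ⟪v, w⟫_ℂ = 0 := by
    have h1 := inner_jucysMurphy (e := e) hρ i v w
    rw [h.2 i (by omega), hww.2 i (by omega), inner_smul_left, inner_smul_right,
      h.conj_eq hρ (by omega), Function.comp, Equiv.swap_apply_left] at h1
    have h2 : (a i - a (i + 1)) * ⟪v, w⟫_ℂ = 0 := by linear_combination h1
    exact (mul_eq_zero.mp h2).resolve_left (sub_ne_zero.mpr hne)
  have hsw : ρ (swap (e i) (e (i + 1))) w = -d • w := by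
    rw [hwdef, map_sub, map_smul, swap_apply_apply_self, smul_sub, smul_smul, neg_mul, hd]
    module
  have o2 : ⟪ρ (swap (e i) (e (i + 1))) v, w⟫_ℂ = 0 := by
    rw [inner_swap_apply hρ, hsw, inner_smul_right, o1, mul_zero]
  refine hww.1 (inner_self_eq_zero (𝕜 := ℂ).mp ?_)
  nth_rewrite 1 [hwdef]
  rw [inner_sub_left, inner_smul_left, o1, o2, mul_zero, sub_zero]

end IsWeightVector

theorem isWeightSet (hρ : ∀ g v w, ⟪ρ g v, ρ g w⟫_ℂ = ⟪v, w⟫_ℂ) (he : Set.InjOn e (Set.Iio N))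
    (hN : 0 < N) : IsWeightSet N {a | ∃ v, IsWeightVector ρ e N a v} where
  zero := by
    rintro a ⟨v, h⟩
    have := h.2 0 hN
    simp only [jucysMurphy, Finset.range_zero, Finset.sum_empty, LinearMap.zero_apply] at this
    exact (smul_eq_zero.mp this.symm).resolve_right h.1
  ne := by
    rintro a ⟨v, h⟩ i hi
    exact h.ne_succ hρ he hi
  swap := by
    rintro a ⟨v, h⟩ i hi h1 h2
    exact h.swap_of_nonadjacent he hi (h.ne_succ hρ he hi) h1 h2
  braid := by
    rintro a ⟨v, h⟩ i hi hd h2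
    obtain ⟨d, hd, had⟩ : ∃ d : ℂ, d * d = 1 ∧ a (i + 1) = a i + d := by
      rcases hd with hd | hd
      exacts [⟨1, by norm_num, hd⟩, ⟨-1, by norm_num, by rw [hd]; ring⟩]
    have e1 := h.swap_apply_eq hρ he (i := i) (by omega) hd had
    have e2 := h.swap_apply_eq hρ he (i := i + 1) (d := -d) (by omega) (by linear_combination hd)
      (by rw [h2, had]; ring)
    have n1 : e i ≠ e (i + 1) := fun h0 =>
      absurd (he (by simp; omega) (by simp; omega) h0) (by omega)
    have n2 : e i ≠ e (i + 1 + 1) := fun h0 =>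
      absurd (he (by simp; omega) (by simp; omega) h0) (by omega)
    have n3 : e (i + 1) ≠ e (i + 1 + 1) := fun h0 =>
      absurd (he (by simp; omega) (by simp; omega) h0) (by omega)
    -- The two adjacent transpositions act on `v` by `d` and `-d`; the braid relation then gives
    -- `-d³ = d³`, contradicting `d² = 1`.
    have hbr : swap (e i) (e (i + 1)) * swap (e (i + 1)) (e (i + 1 + 1)) * swap (e i) (e (i + 1)) =
        swap (e (i + 1)) (e (i + 1 + 1)) * swap (e i) (e (i + 1)) *
          swap (e (i + 1)) (e (i + 1 + 1)) := by
      rw [Equiv.swap_mul_swap_mul_swap n1 n2, Equiv.swap_comm (e i) (e (i + 1)),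
        Equiv.swap_comm (e (i + 1)) (e (i + 1 + 1)),
        Equiv.swap_mul_swap_mul_swap n3.symm n2.symm, Equiv.swap_comm]
    have e3 := congrArg (fun g => ρ g v) hbr
    simp only [map_mul, Module.End.mul_apply, e1, e2, map_smul, smul_smul] at e3
    have e4 := smul_left_injective ℂ h.1 e3
    have e5 : d = 0 := by linear_combination -(1 / 2) * e4 - d * hd
    simp [e5] at hd

end Unitary
end
-- Cycles on a set of letters and their sums.
noncomputable section

open Equiv (swap)

section FullCycles

open Equiv.Perm

variable {α : Type*}

/-- `σ` permutes `S` cyclically and fixes all other points. -/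
def IsFullCycle (σ : Equiv.Perm α) (S : Finset α) : Prop :=
  (∀ x ∉ S, σ x = x) ∧ ∀ x ∈ S, ∀ y ∈ S, σ.SameCycle x y

variable {σ τ : Equiv.Perm α} {S : Finset α} {x y : α}

theorem isFullCycle_of_forall_sameCycle (h : ∀ z ∉ S, σ z = z) (h' : ∀ z ∈ S, σ.SameCycle x z) :
    IsFullCycle σ S :=
  ⟨h, fun a ha b hb => (h' a ha).symm.trans (h' b hb)⟩

variable [Fintype α] [DecidableEq α]

/-- The product sends `x` to `y` and `y` to `σ x`, so `y` is inserted into the cycle just after `x`.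
-/
theorem IsFullCycle.mul_swap (h : IsFullCycle σ S) (hx : x ∈ S) (hy : y ∉ S) :
    IsFullCycle (σ * swap x y) (insert y S) := by
  have hxy : x ≠ y := fun h => hy (h ▸ hx)
  set τ := σ * swap x y with hτ
  have t1 : τ y = σ x := by simp [hτ]
  have t2 : τ x = y := by simp [hτ, h.1 y hy]
  have t3 : ∀ z, z ≠ x → z ≠ y → τ z = σ z := fun z h1 h2 => by
    simp [hτ, Equiv.swap_apply_of_ne_of_ne h1 h2]
  refine isFullCycle_of_forall_sameCycle (x := y) (fun z hz => ?_) fun z hz => ?_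
  · rw [Finset.mem_insert, not_or] at hz
    rw [t3 z (fun h => hz.2 (h ▸ hx)) hz.1, h.1 z hz.2]
  rcases Finset.mem_insert.mp hz with rfl | hz
  · exact SameCycle.refl _ _
  have key : ∀ k : ℕ, τ.SameCycle y ((σ ^ k) x) := by
    intro k
    induction k with
    | zero => rw [pow_zero, one_apply, ← t2, sameCycle_apply_left]
    | succ k ih =>
      rw [pow_succ', mul_apply]
      by_cases h1 : (σ ^ k) x = x
      · rw [h1, ← t1, sameCycle_apply_right]
      · have h2 : (σ ^ k) x ≠ y := fun h2 => hxy ((σ ^ k).injective (by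
          rw [h2, Function.IsFixedPt.perm_pow (h.1 y hy)]))
        rwa [← t3 _ h1 h2, sameCycle_apply_right]
  obtain ⟨k, -, hk⟩ := (h.2 x hx z hz).exists_pow_eq'
  exact hk ▸ key k

omit [Fintype α] in
theorem IsFullCycle.inv_apply_mem (h : IsFullCycle τ (insert y S)) (hy : y ∉ S)
    (hS : S.Nonempty) : τ⁻¹ y ∈ S := by
  obtain ⟨s, hs⟩ := hS
  have h1 : τ⁻¹ y ∈ insert y S := by
    by_contra h1
    have h2 := h.1 _ h1
    rw [show τ (τ⁻¹ y) = y by simp] at h2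
    exact h1 (by rw [← h2]; exact Finset.mem_insert_self _ _)
  rcases Finset.mem_insert.mp h1 with h2 | h2
  · have h3 : τ y = y := by rw [inv_eq_iff_eq] at h2; exact h2.symm
    have h4 := h.2 y (Finset.mem_insert_self _ _) s (Finset.mem_insert_of_mem hs)
    exact absurd ((h4.eq_of_left h3) ▸ hs) hy
  · exact h2

theorem IsFullCycle.of_insert (h : IsFullCycle τ (insert y S)) (hy : y ∉ S) (hS : S.Nonempty) :
    IsFullCycle (τ * swap (τ⁻¹ y) y) S := by
  have hx := h.inv_apply_mem hy hS
  set x := τ⁻¹ y with hxdef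
  have hxy : x ≠ y := fun h => hy (h ▸ hx)
  have tx : τ x = y := by simp [hxdef]
  set σ := τ * swap x y with hσ
  have t1 : σ y = y := by simp [hσ, tx]
  have t2 : σ x = τ y := by simp [hσ]
  have t3 : ∀ z, z ≠ x → z ≠ y → σ z = τ z := fun z h1 h2 => by
    simp [hσ, Equiv.swap_apply_of_ne_of_ne h1 h2]
  refine isFullCycle_of_forall_sameCycle (x := x) (fun z hz => ?_) fun z hz => ?_
  · by_cases hzy : z = y
    · rw [hzy, t1]
    · rw [t3 z (fun h => hz (h ▸ hx)) hzy, h.1 z (by simp [hz, hzy])]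
  have key : ∀ k : ℕ, (τ ^ k) x = y ∨ σ.SameCycle x ((τ ^ k) x) := by
    intro k
    induction k with
    | zero => exact .inr (SameCycle.refl _ _)
    | succ k ih =>
      rw [pow_succ', mul_apply]
      by_cases h1 : (τ ^ k) x = y
      · rw [h1, ← t2, sameCycle_apply_right]; exact .inr (SameCycle.refl _ _)
      by_cases h2 : (τ ^ k) x = x
      · exact .inl (by rw [h2, tx])
      · rw [← t3 _ h2 h1, sameCycle_apply_right]
        exact .inr (ih.resolve_left h1)
  obtain ⟨k, -, hk⟩ := (h.2 x (Finset.mem_insert_of_mem hx) z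
    (Finset.mem_insert_of_mem hz)).exists_pow_eq'
  exact hk ▸ (key k).resolve_left (fun h => hy (by rw [← h, hk]; exact hz))

open Classical in
/-- The finset of permutations that permute `S` cyclically and fix all other points. -/
def fullCycles (S : Finset α) : Finset (Equiv.Perm α) := {σ | IsFullCycle σ S}

theorem mem_fullCycles : σ ∈ fullCycles S ↔ IsFullCycle σ S := by simp [fullCycles]

/-- A full cycle on the larger set is determined by the predecessor `x` of `y` and the cycle left
after deleting `y`. -/
theorem sum_fullCycles_insert {M : Type*} [AddCommMonoid M] (f : Equiv.Perm α → M) (hy : y ∉ S)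
    (hS : S.Nonempty) :
    ∑ τ ∈ fullCycles (insert y S), f τ = ∑ σ ∈ fullCycles S, ∑ x ∈ S, f (σ * swap x y) := by
  rw [← Finset.sum_product' (f := fun σ x => f (σ * swap x y))]
  refine Finset.sum_nbij' (fun τ => (τ * swap (τ⁻¹ y) y, τ⁻¹ y)) (fun q => q.1 * swap q.2 y)
    (fun τ hτ => ?_) (fun q hq => ?_) (fun τ _ => ?_) (fun q hq => ?_) (fun τ _ => ?_)
  · rw [mem_fullCycles] at hτ
    exact Finset.mem_product.mpr ⟨mem_fullCycles.mpr (hτ.of_insert hy hS), hτ.inv_apply_mem hy hS⟩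
  · rw [Finset.mem_product, mem_fullCycles] at hq
    exact mem_fullCycles.mpr (hq.1.mul_swap hq.2 hy)
  · simp [mul_assoc]
  · rw [Finset.mem_product, mem_fullCycles] at hq
    have h1 : (q.1 * swap q.2 y)⁻¹ y = q.2 := by
      rw [inv_eq_iff_eq, mul_apply, Equiv.swap_apply_left, hq.1.1 y hy]
    simp only [h1]
    ext1
    · simp [mul_assoc]
    · rfl
  · simp [mul_assoc]

theorem fullCycles_singleton : fullCycles ({x} : Finset α) = {1} := by
  ext σ
  rw [mem_fullCycles, Finset.mem_singleton]
  refine ⟨fun h => ?_, ?_⟩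
  · have h1 : ∀ z, z ≠ x → σ z = z := fun z hz => h.1 z (by simpa using hz)
    ext z
    by_cases hz : z = x
    · subst hz
      by_contra h2
      exact h2 (σ.injective (h1 _ h2))
    · rw [h1 z hz, one_apply]
  · rintro rfl
    exact ⟨fun _ _ => rfl, fun a ha b hb => by
      rw [Finset.mem_singleton.mp ha, Finset.mem_singleton.mp hb]⟩

theorem card_fullCycles (hS : S.Nonempty) : (fullCycles S).card = (S.card - 1).factorial := by
  induction hS using Finset.Nonempty.cons_induction with
  | singleton a => simp [fullCycles_singleton]
  | cons a s ha hs ih =>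
    rw [Finset.cons_eq_insert, Finset.card_eq_sum_ones, sum_fullCycles_insert _ ha hs]
    simp only [Finset.sum_const, smul_eq_mul, mul_one, ih]
    rw [Finset.card_insert_of_notMem ha, Nat.add_sub_cancel, mul_comm,
      Nat.mul_factorial_pred hs.card_pos.ne']

omit [Fintype α] [DecidableEq α] in
theorem IsFullCycle.pow_card (h : IsFullCycle σ S) : σ ^ S.card = 1 := by
  have hc : σ.IsCycleOn (S : Set α) := by
    have hm : Set.MapsTo σ S S := fun x hx => by
      by_contra h1
      exact h1 (by rw [σ.injective (h.1 _ h1)]; exact hx)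
    refine ⟨⟨hm, σ.injective.injOn, fun y hy => ?_⟩, fun x hx y hy => h.2 x hx y hy⟩
    refine ⟨σ⁻¹ y, ?_, by simp⟩
    by_contra h1
    have h2 := h.1 _ h1
    rw [show σ (σ⁻¹ y) = y by simp] at h2
    exact h1 (h2 ▸ hy)
  ext x
  by_cases hx : x ∈ S
  · exact hc.pow_card_apply hx
  · exact Function.IsFixedPt.perm_pow (h.1 x hx) _

omit [Fintype α] [DecidableEq α] in
theorem IsFullCycle.pow (h : IsFullCycle σ S) {m m' : ℕ} (hm : m * m' ≡ 1 [MOD S.card]) :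
    (σ ^ m) ^ m' = σ ∧ IsFullCycle (σ ^ m) S := by
  have h1 : (σ ^ m) ^ m' = σ := by
    rw [← pow_mul]
    conv_rhs => rw [← pow_one σ]
    rw [pow_eq_pow_iff_modEq]
    exact hm.of_dvd (orderOf_dvd_of_pow_eq_one h.pow_card)
  refine ⟨h1, fun x hx => Function.IsFixedPt.perm_pow (h.1 x hx) _, fun x hx y hy => ?_⟩
  obtain ⟨k, hk⟩ := h.2 x hx y hy
  exact ⟨m' * k, by rw [zpow_mul, zpow_natCast, h1, hk]⟩

/-- Raising to a power prime to the length permutes the full cycles, the inverse being the power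
`m'`. -/
theorem sum_fullCycles_pow {M : Type*} [AddCommMonoid M] (f : Equiv.Perm α → M) {m m' : ℕ}
    (hm : m * m' ≡ 1 [MOD S.card]) :
    ∑ σ ∈ fullCycles S, f (σ ^ m) = ∑ σ ∈ fullCycles S, f σ := by
  have hm' : m' * m ≡ 1 [MOD S.card] := by rwa [mul_comm]
  refine Finset.sum_nbij' (· ^ m) (· ^ m') ?_ ?_ ?_ ?_ ?_ <;> intro σ hσ <;>
    simp only [mem_fullCycles] at hσ ⊢
  exacts [(hσ.pow hm).2, (hσ.pow hm').2, (hσ.pow hm).1, (hσ.pow hm').1]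

end FullCycles

/-! ### The class sum of cycles on a joint eigenvector. -/

section

variable {α V : Type*} [Fintype α] [DecidableEq α] [AddCommGroup V] [Module ℂ V]
  {ρ : Representation ℂ (Equiv.Perm α) V} {e : ℕ → α} {N : ℕ} {a : ℕ → ℂ} {v : V}

/-- Inserting the letters one after another factors the sum of all cycles on the first `k + 1`
letters into `J_1 ⋯ J_k`. -/
theorem IsWeightVector.sum_fullCycles (he : Set.InjOn e (Set.Iio N)) (h : IsWeightVector ρ e N a v)
    (k : ℕ) (hk : k < N) :
    ∑ σ ∈ fullCycles ((Finset.range (k + 1)).image e), ρ σ v =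
      (∏ l ∈ Finset.Ico 1 (k + 1), a l) • v := by
  induction k with
  | zero => simp [fullCycles_singleton]
  | succ k ih =>
    rw [Finset.range_add_one, Finset.image_insert, sum_fullCycles_insert]
    · simp only [map_mul, Module.End.mul_apply]
      simp_rw [← map_sum, ← LinearMap.sum_apply]
      rw [← jucysMurphy_eq_sum_image ρ he hk, h.2 _ hk]
      simp_rw [map_smul]
      rw [LinearMap.sum_apply, ih (by omega), smul_smul, mul_comm,
        ← Finset.prod_Ico_succ_top (by omega)]
    · simp only [Finset.mem_image, Finset.mem_range, not_exists, not_and]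
      intro i hi h0
      exact absurd (he (by simp; omega) (by simpa using hk) h0) (by omega)
    · exact ⟨e 0, Finset.mem_image_of_mem _ (by simp)⟩

/-- For a `p`-cycle `σ`, the vector `∑ σ^m v` is fixed by `σ`, hence zero. Summed over the `(p-1)!`
cycles, the term `m = 0` gives `(p-1)! v`. Each of the other `p - 1` terms gives the class sum
applied to `v`, because a nonzero power permutes the `p`-cycles. -/
theorem IsWeightVector.prod_eq_of_forall_fixed {p : ℕ} (hp : p.Prime) (hpN : p ≤ N)
    (he : Set.InjOn e (Set.Iio N)) (h : IsWeightVector ρ e N a v)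
    (hfix : ∀ σ, IsFullCycle σ ((Finset.range p).image e) → ∀ w, ρ σ w = w → w = 0) :
    ∏ l ∈ Finset.Ico 1 p, a l = -((p - 2).factorial : ℂ) := by
  have hp2 := hp.two_le
  set S := (Finset.range p).image e with hS
  have hScard : S.card = p := by
    rw [hS, Finset.card_image_of_injOn (he.mono fun i hi => ?_), Finset.card_range]
    simp at hi ⊢; omega
  have hSne : S.Nonempty := Finset.card_pos.mp (by omega)
  have h0 : ∀ σ ∈ fullCycles S, ∑ m ∈ Finset.range p, ρ (σ ^ m) v = 0 := by
    intro σ hσ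
    rw [mem_fullCycles] at hσ
    refine hfix σ hσ _ ?_
    have h1 : ∀ m, ρ σ (ρ (σ ^ m) v) = ρ (σ ^ (m + 1)) v := fun m => by
      rw [pow_succ', map_mul, Module.End.mul_apply]
    rw [map_sum]
    simp_rw [h1]
    have h2 := Finset.sum_range_succ (fun m => ρ (σ ^ m) v) p
    rw [Finset.sum_range_succ', ← hScard, hσ.pow_card, pow_zero, hScard] at h2
    exact add_right_cancel h2
  have h1 := Finset.sum_eq_zero h0
  rw [Finset.sum_comm, ← Finset.sum_range_add_sum_Ico _ (show 1 ≤ p by omega)] at h1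
  have h2 : ∀ m ∈ Finset.Ico 1 p, ∑ σ ∈ fullCycles S, ρ (σ ^ m) v =
      ∑ σ ∈ fullCycles S, ρ σ v := by
    intro m hm
    rw [Finset.mem_Ico] at hm
    have hcop : m.Coprime p := (hp.coprime_iff_not_dvd.mpr
      (Nat.not_dvd_of_pos_of_lt (by omega) hm.2)).symm
    obtain ⟨m', hm'⟩ := Nat.exists_mul_mod_eq_one_of_coprime hcop (by omega)
    refine sum_fullCycles_pow (fun σ => ρ σ v) (m' := m') ?_
    rw [hScard, Nat.ModEq, hm'.2, Nat.mod_eq_of_lt (by omega)]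
  have h3 := h.sum_fullCycles he (p - 1) (by omega)
  rw [show p - 1 + 1 = p by omega] at h3
  rw [Finset.sum_congr rfl h2, h3] at h1
  simp only [Finset.sum_range_one, pow_zero, map_one, Module.End.one_apply, Finset.sum_const,
    Nat.card_Ico, card_fullCycles hSne, hScard] at h1
  obtain ⟨q, rfl⟩ : ∃ q, p = q + 2 := ⟨p - 2, by omega⟩
  simp only [Nat.add_sub_cancel, show q + 2 - 1 = q + 1 by omega, Nat.factorial_succ] at h1 ⊢
  rw [← Nat.cast_smul_eq_nsmul ℂ, ← Nat.cast_smul_eq_nsmul ℂ, smul_smul, ← add_smul] at h1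
  have h4 := (smul_eq_zero.mp h1).resolve_right h.1
  have h5 : ((q + 1 : ℕ) : ℂ) ≠ 0 := Nat.cast_ne_zero.mpr (by omega)
  push_cast at h4 h5
  have h6 : ((q : ℂ) + 1) * (∏ l ∈ Finset.Ico 1 (q + 2), a l + q.factorial) = 0 := by
    linear_combination h4
  exact eq_neg_of_add_eq_zero_left ((mul_eq_zero.mp h6).resolve_left h5)

end
end
-- Odd cycles with nonzero fixed vectors.
noncomputable section

open Equiv (swap)

theorem Representation.exists_invariant_innerProductSpaceCore {G V : Type*} [Group G] [Finite G]
    [AddCommGroup V] [Module ℂ V] [FiniteDimensional ℂ V] (ρ : Representation ℂ G V) :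
    ∃ c : InnerProductSpace.Core ℂ V, ∀ g v w, c.inner (ρ g v) (ρ g w) = c.inner v w := by
  have := Fintype.ofFinite G
  obtain ⟨φ⟩ : Nonempty (V ≃ₗ[ℂ] EuclideanSpace ℂ (Fin (Module.finrank ℂ V))) :=
    ⟨LinearEquiv.ofFinrankEq _ _ (by simp)⟩
  refine ⟨{ inner := fun v w => ∑ g, inner ℂ (φ (ρ g v)) (φ (ρ g w))
            conj_inner_symm := fun v w => by simp
            re_inner_nonneg := fun v => ?_
            add_left := fun u v w => by simp [Finset.sum_add_distrib]
            smul_left := fun v w r => by simp [Finset.mul_sum, mul_comm]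
            definite := fun v hv => ?_ }, fun h v w => ?_⟩
  · rw [map_sum]
    exact Finset.sum_nonneg fun g _ => inner_self_nonneg
  · have h1 : ∑ g, RCLike.re (inner ℂ (φ (ρ g v)) (φ (ρ g v))) = 0 := by
      rw [← map_sum]; simpa using congrArg RCLike.re hv
    have h2 := (Finset.sum_eq_zero_iff_of_nonneg fun g _ => inner_self_nonneg).mp h1 1
      (Finset.mem_univ _)
    rw [map_one, Module.End.one_apply] at h2
    have h3 : φ v = 0 := by
      rw [inner_self_eq_norm_sq] at h2
      simpa using h2
    simpa using h3
  · refine Fintype.sum_equiv (Equiv.mulRight h) _ _ fun g => ?_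
    simp [map_mul]

section

variable {α V : Type*} [Fintype α] [DecidableEq α] [AddCommGroup V] [Module ℂ V]

theorem IsFullCycle.isCycle {σ : Equiv.Perm α} {S : Finset α} (h : IsFullCycle σ S)
    (hS : 2 ≤ S.card) : σ.IsCycle ∧ σ.support = S := by
  obtain ⟨x, hx, y, hy, hxy⟩ := Finset.one_lt_card.mp hS
  have hne : ∀ z ∈ S, σ z ≠ z := fun z hz h0 => by
    have h1 := (h.2 z hz x hx).eq_of_left h0
    have h2 := (h.2 z hz y hy).eq_of_left h0
    exact hxy (h1.symm.trans h2)
  have hsupp : σ.support = S := by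
    ext z
    rw [Equiv.Perm.mem_support]
    exact ⟨fun h1 => by_contra fun h2 => h1 (h.1 z h2), hne z⟩
  refine ⟨⟨x, hne x hx, fun z hz => h.2 x hx z ?_⟩, hsupp⟩
  rw [← hsupp]; exact Equiv.Perm.mem_support.mpr hz

theorem exists_injOn_Iio (α : Type*) [Fintype α] [Nonempty α] :
    ∃ e : ℕ → α, Set.InjOn e (Set.Iio (Fintype.card α)) := by
  let f := (Fintype.equivFin α).symm
  have h0 := Fintype.card_pos (α := α)
  refine ⟨fun i => if h : i < Fintype.card α then f ⟨i, h⟩ else f ⟨0, h0⟩, fun i hi j hj h => ?_⟩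
  simp only [Set.mem_Iio] at hi hj
  simpa [hi, hj] using h

/-- In a representation of a symmetric group of degree greater than the prime `p ≥ 5`,
some `p`-cycle has a nonzero fixed vector. -/
theorem exists_fixed_of_prime_lt_card [FiniteDimensional ℂ V] [Nontrivial V]
    (ρ : Representation ℂ (Equiv.Perm α) V) {p : ℕ} (hp : p.Prime) (hp5 : 5 ≤ p)
    (hcard : p < Fintype.card α) :
    ∃ σ : Equiv.Perm α, σ.IsCycle ∧ σ.support.card = p ∧ ∃ v ≠ 0, ρ σ v = v := by
  by_contra! hno
  have : Nonempty α := Fintype.card_pos_iff.mp (by omega)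
  obtain ⟨e, he⟩ := exists_injOn_Iio α
  -- Only the first `p + 1` letters matter: one letter beyond `p` suffices for the contradiction.
  have he : Set.InjOn e (Set.Iio (p + 1)) := he.mono (Set.Iio_subset_Iio hcard)
  obtain ⟨c, hc⟩ := ρ.exists_invariant_innerProductSpaceCore
  let _ : NormedAddCommGroup V := c.toNormedAddCommGroup
  let _ : InnerProductSpace ℂ V := .ofCore c.toCore
  have hA := isWeightSet (ρ := ρ) hc he (by omega)
  obtain ⟨a, v, h⟩ := exists_isWeightVector (ρ := ρ) he
  have hS : ((Finset.range p).image e).card = p := by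
    rw [Finset.card_image_of_injOn (he.mono fun i hi => ?_), Finset.card_range]
    simp at hi ⊢; omega
  refine hA.notMem_of_prod (κ := -((p - 2).factorial : ℂ)) (by omega)
    (hp.odd_of_ne_two (by omega)) (neg_ne_zero.mpr (Nat.cast_ne_zero.mpr (Nat.factorial_ne_zero _)))
    (fun h0 => ?_) (fun b hb => ?_) a ⟨v, h⟩
  · have h1 : (((p - 1).factorial + (p - 2).factorial : ℕ) : ℂ) = 0 := by
      push_cast; linear_combination -h0
    have := Nat.cast_eq_zero.mp h1
    have := (p - 1).factorial_pos
    omega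
  · obtain ⟨w, hw⟩ := hb
    refine hw.prod_eq_of_forall_fixed hp (by omega) he fun σ hσ w hw => ?_
    by_contra hw0
    obtain ⟨h1, h2⟩ := hσ.isCycle (by omega)
    exact hno σ h1 (by rw [h2, hS]) w hw0 hw

omit [Fintype α] in
theorem apply_formPerm_of_forall_swap {ρ : Representation ℂ (Equiv.Perm α) V} {e : ℕ → α}
    {v : V} {c : ℂ} (k i : ℕ)
    (h : ∀ j, i ≤ j → j < i + k → ρ (swap (e j) (e (j + 1))) v = c • v) :
    ρ ((List.range' i (k + 1)).map e).formPerm v = c ^ k • v := by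
  induction k generalizing i with
  | zero => simp
  | succ k ih =>
    rw [List.range'_succ, List.range'_succ, List.map_cons, List.map_cons,
      List.formPerm_cons_cons, ← List.map_cons, ← List.range'_succ, map_mul, Module.End.mul_apply,
      ih (i + 1) (fun j h1 h2 => h j (by omega) (by omega)), map_smul,
      h i le_rfl (by omega), smul_smul, pow_succ]

/-- In a representation of a symmetric group of prime degree `p ≥ 5`, some cycle of length `p`
or `p - 2` has a nonzero fixed vector. -/
theorem exists_fixed_of_prime_card [FiniteDimensional ℂ V] [Nontrivial V]
    (ρ : Representation ℂ (Equiv.Perm α) V) {p : ℕ} (hp : p.Prime) (hp5 : 5 ≤ p)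
    (hcard : Fintype.card α = p) :
    ∃ σ : Equiv.Perm α, σ.IsCycle ∧ (σ.support.card = p ∨ σ.support.card = p - 2) ∧
      ∃ v ≠ 0, ρ σ v = v := by
  by_contra! hno
  have : Nonempty α := Fintype.card_pos_iff.mp (by omega)
  obtain ⟨e, he⟩ := exists_injOn_Iio α
  rw [hcard] at he
  obtain ⟨c, hc⟩ := ρ.exists_invariant_innerProductSpaceCore
  let _ : NormedAddCommGroup V := c.toNormedAddCommGroup
  let _ : InnerProductSpace ℂ V := .ofCore c.toCore
  have hA := isWeightSet (ρ := ρ) hc he (by omega)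
  obtain ⟨a, v, h⟩ := exists_isWeightVector (ρ := ρ) he
  have hS : ((Finset.range p).image e).card = p := by
    rw [Finset.card_image_of_injOn (he.mono fun i hi => ?_), Finset.card_range]
    simpa using hi
  obtain ⟨b, ⟨w, hw⟩, hb⟩ := hA.exists_straight (by omega) (fun b hb => by
    obtain ⟨w, hw⟩ := hb
    refine hw.prod_eq_of_forall_fixed hp le_rfl he fun σ hσ w hw => ?_
    by_contra hw0
    obtain ⟨h1, h2⟩ := hσ.isCycle (by omega)
    exact hno σ h1 (.inl (by rw [h2, hS])) w hw0 hw) ⟨v, h⟩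
  obtain ⟨d, hd, hb⟩ : ∃ d : ℂ, d * d = 1 ∧ ∀ i < p - 1, b i = i * d := by
    rcases hb with hb | hb
    · exact ⟨1, by norm_num, fun i hi => by rw [hb i hi, mul_one]⟩
    · exact ⟨-1, by norm_num, fun i hi => by rw [hb i hi]; ring⟩
  have hswap : ∀ j, 0 ≤ j → j < 0 + (p - 3) → ρ (swap (e j) (e (j + 1))) w = d • w :=
    fun j _ hj => hw.swap_apply_eq hc he (by omega) hd (by
      rw [hb _ (by omega), hb _ (by omega)]; push_cast; ring)
  have h1 := apply_formPerm_of_forall_swap (p - 3) 0 hswap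
  -- The cycle on the first `p - 2` letters is a product of `p - 3` adjacent transpositions, each
  -- acting on `w` by `d = ±1`. This number is even, so the sign disappears.
  have hdp : d ^ (p - 3) = 1 := by
    obtain ⟨q, hq⟩ := hp.odd_of_ne_two (by omega)
    rw [show p - 3 = 2 * (q - 1) by omega, pow_mul, pow_two, hd, one_pow]
  rw [hdp, one_smul] at h1
  set l := (List.range' 0 (p - 3 + 1)).map e with hl
  have hlen : l.length = p - 2 := by simp [hl]; omega
  have hnd : l.Nodup := by
    rw [hl, List.nodup_map_iff_inj_on (List.nodup_range' ..)]
    intro i hi j hj h0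
    simp only [List.mem_range'_1] at hi hj
    exact he (by simp; omega) (by simp; omega) h0
  refine hno l.formPerm (List.isCycle_formPerm hnd (by omega)) (.inr ?_) w hw.1 h1
  rw [List.support_formPerm_of_nodup l hnd (fun x h0 => by rw [h0] at hlen; simp at hlen; omega),
    List.toFinset_card_of_nodup hnd, hlen]

end
end
-- Vectors fixed by even centralizers.
noncomputable section

open Equiv (swap)
open Equiv.Perm

section EvenCentralizer

variable {α V : Type*} [Fintype α] [DecidableEq α] [AddCommGroup V] [Module ℂ V]

/-- Some nonzero vector is fixed by all even permutations commuting with `g`. -/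
def FixedByEvenCentralizer (ρ : Representation ℂ (Equiv.Perm α) V) (g : Equiv.Perm α) : Prop :=
  ∃ v ≠ 0, ∀ τ, sign τ = 1 → Commute τ g → ρ τ v = v

variable (ρ : Representation ℂ (Equiv.Perm α) V)

/-- The vectors fixed by `c`. -/
def fixedSubmodule (c : Equiv.Perm α) : Submodule ℂ V := LinearMap.ker (ρ c - 1)

omit [Fintype α] [DecidableEq α] in
variable {ρ} in
theorem mem_fixedSubmodule {c : Equiv.Perm α} {v : V} : v ∈ fixedSubmodule ρ c ↔ ρ c v = v := by
  simp [fixedSubmodule, sub_eq_zero]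

theorem disjoint_ofSubtype_notMem_support (c : Equiv.Perm α) (τ : Equiv.Perm {x // x ∉ c.support}) :
    Disjoint c (ofSubtype τ) := fun x => by
  by_cases hx : x ∈ c.support
  · exact .inr (ofSubtype_apply_of_not_mem τ (by simpa using hx))
  · exact .inl (notMem_support.mp hx)

/-- The permutations of the points fixed by `c` act on the vectors fixed by `c`. -/
def fixedRep (c : Equiv.Perm α) :
    Representation ℂ (Equiv.Perm {x // x ∉ c.support}) (fixedSubmodule ρ c) where
  toFun τ := (ρ (ofSubtype τ)).restrict (p := fixedSubmodule ρ c) fun v hv => by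
    rw [mem_fixedSubmodule] at hv ⊢
    rw [← Module.End.mul_apply, ← map_mul, (disjoint_ofSubtype_notMem_support c τ).commute.eq,
      map_mul, Module.End.mul_apply, hv]
  map_one' := by ext; simp
  map_mul' σ τ := by ext; simp

variable {ρ}

omit [Fintype α] [DecidableEq α] in
theorem zpow_apply_of_fixed {c : Equiv.Perm α} {v : V} (h : ρ c v = v) (i : ℤ) :
    ρ (c ^ i) v = v := by
  have hinv : ρ c⁻¹ v = v := by
    conv_lhs => rw [← h]
    rw [← Module.End.mul_apply, ← map_mul, inv_mul_cancel, map_one, Module.End.one_apply]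
  induction i with
  | zero => simp
  | succ i ih => rw [zpow_add_one, map_mul, Module.End.mul_apply, h, ih]
  | pred i ih => rw [zpow_sub_one, map_mul, Module.End.mul_apply, hinv, ih]

-- Conjugation by `τ` permutes the cycles of the product, and `c` is the only one of its length.
omit [AddCommGroup V] [Module ℂ V] in
theorem commute_of_commute_mul_ofSubtype {c : Equiv.Perm α} (hc : c.IsCycle)
    {h : Equiv.Perm {x // x ∉ c.support}} (hh : c.support.card ∉ h.cycleType) {τ : Equiv.Perm α}
    (hτ : Commute τ (c * ofSubtype h)) : Commute τ c := by
  have h1 : τ * (c * ofSubtype h) * τ⁻¹ = c * ofSubtype h := by rw [hτ.eq]; simp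
  have hf := (disjoint_ofSubtype_notMem_support c h).cycleFactorsFinset_mul_eq_union
  have h2 := (mem_cycleFactorsFinset_conj (c * ofSubtype h) τ c).mpr (by
    rw [hf, cycleFactorsFinset_eq_singleton_self_iff.mpr hc]; simp)
  rw [h1, hf, cycleFactorsFinset_eq_singleton_self_iff.mpr hc, Finset.mem_union,
    Finset.mem_singleton] at h2
  rcases h2 with h2 | h2
  · exact mul_inv_eq_iff_eq_mul.mp h2
  · exfalso
    apply hh
    rw [← cycleType_ofSubtype (g := h), cycleType_def]
    exact Multiset.mem_map.mpr ⟨_, h2, by simp⟩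

/-- Combining a cycle of odd length with a permutation of the remaining points
having no cycle of this length. -/
theorem FixedByEvenCentralizer.mul_ofSubtype {c : Equiv.Perm α} (hc : c.IsCycle)
    (hodd : Odd c.support.card) {h : Equiv.Perm {x // x ∉ c.support}}
    (hh : c.support.card ∉ h.cycleType) (hfix : FixedByEvenCentralizer (fixedRep ρ c) h) :
    FixedByEvenCentralizer ρ (c * ofSubtype h) := by
  obtain ⟨⟨v, hv⟩, hv0, hfix⟩ := hfix
  refine ⟨v, fun h0 => hv0 (Subtype.ext h0), fun τ hτ hcomm => ?_⟩
  rw [mem_fixedSubmodule] at hv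
  have hτc := commute_of_commute_mul_ofSubtype hc hh hcomm
  have hτh : Commute τ (ofSubtype h) := by
    have := (hτc.inv_right).mul_right hcomm
    rwa [inv_mul_cancel_left] at this
  obtain ⟨hs, i, hi⟩ := hc.commute_iff.mp hτc
  -- On the support of `c`, `τ` agrees with `c ^ i`, so `t` moves only the other letters. It is even
  -- because `c` has odd length, so the hypothesis on `h` applies to it.
  set t := c ^ (-i) * τ with ht
  have hi : c ^ i = ofSubtype (τ.subtypePerm hs) := hi
  have t1 : ∀ x ∈ c.support, t x = x := fun x hx => by
    have h1 : (c ^ i) x = τ x := by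
      rw [hi]; exact ofSubtype_subtypePerm_of_mem hs hx
    rw [ht, mul_apply, ← h1, ← mul_apply, ← zpow_add]; simp
  have t2 : ∀ x, t x ∉ c.support ↔ x ∉ c.support := fun x => not_congr
    ⟨fun hx => by rwa [t.injective (t1 _ hx)] at hx, fun hx => by rwa [t1 x hx]⟩
  obtain ⟨t', t3⟩ : ∃ t' : Equiv.Perm {x // x ∉ c.support}, ofSubtype t' = t :=
    ⟨t.subtypePerm (p := fun x => x ∉ c.support) t2,
      ofSubtype_subtypePerm t2 fun x hx hx' => hx (t1 x hx')⟩
  have hsign : sign t = 1 := by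
    have : sign c = 1 := by rw [hc.sign, hodd.neg_one_pow, neg_neg]
    rw [ht, map_mul, hτ, map_zpow, this, one_zpow, one_mul]
  have t4 : Commute t' h := by
    apply ofSubtype_injective
    have h1 : Commute (ofSubtype t') (ofSubtype h) := by
      rw [t3]
      exact (((disjoint_ofSubtype_notMem_support c h).commute).zpow_left _).mul_left hτh
    simpa using h1.eq
  have t5 := congrArg Subtype.val
    (hfix t' (by rw [← sign_ofSubtype, t3, hsign]) t4)
  have t6 : ρ t v = v := by
    simpa [fixedRep, t3] using t5
  have t7 : τ = c ^ i * t := by rw [ht]; simp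
  rw [t7, map_mul, Module.End.mul_apply, t6, zpow_apply_of_fixed hv]

theorem eq_one_of_card_le_two {β : Type*} [Fintype β] [DecidableEq β] (hβ : Fintype.card β ≤ 2)
    {τ : Equiv.Perm β} (hτ : sign τ = 1) : τ = 1 := by
  rw [← card_support_le_one]
  have h1 := τ.support.card_le_univ
  by_contra! h2
  obtain ⟨x, y, hxy, rfl⟩ := card_support_eq_two.mp (by omega : τ.support.card = 2)
  rw [sign_swap hxy] at hτ
  exact absurd hτ (by decide)

theorem fixedByEvenCentralizer_of_card_le_two [Nontrivial V] (hα : Fintype.card α ≤ 2)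
    (g : Equiv.Perm α) : FixedByEvenCentralizer ρ g := by
  obtain ⟨v, hv⟩ := exists_ne (0 : V)
  refine ⟨v, hv, fun τ hτ _ => ?_⟩
  rw [eq_one_of_card_le_two hα hτ, map_one, Module.End.one_apply]

theorem card_notMem_support (c : Equiv.Perm α) :
    Fintype.card {x // x ∉ c.support} = Fintype.card α - c.support.card := by
  rw [Fintype.card_subtype_compl, Fintype.card_coe]

omit [Fintype α] [DecidableEq α] in
theorem nontrivial_fixedSubmodule {c : Equiv.Perm α} {v : V} (hv : v ≠ 0) (h : ρ c v = v) :
    Nontrivial (fixedSubmodule ρ c) :=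
  ⟨⟨v, mem_fixedSubmodule.mpr h⟩, 0, fun h0 => hv (congrArg Subtype.val h0)⟩

/-- A fixed vector of an odd cycle missing at most two points. -/
theorem fixedByEvenCentralizer_of_isCycle {c : Equiv.Perm α} (hc : c.IsCycle)
    (hodd : Odd c.support.card) (hcard : Fintype.card α ≤ c.support.card + 2) {v : V} (hv : v ≠ 0)
    (h : ρ c v = v) : FixedByEvenCentralizer ρ c := by
  have := nontrivial_fixedSubmodule hv h
  have h1 := FixedByEvenCentralizer.mul_ofSubtype hc hodd (h := 1) (by simp)
    (fixedByEvenCentralizer_of_card_le_two (ρ := fixedRep ρ c)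
      (by rw [card_notMem_support]; omega) 1)
  simpa using h1

end EvenCentralizer

/-! ### Degree four, and fixed vectors of 3-cycles. -/

section KleinFour

/-- The double transpositions of four letters, together with the identity. -/
def kleinFour : Finset (Equiv.Perm (Fin 4)) :=
  {1, swap 0 1 * swap 2 3, swap 0 2 * swap 1 3, swap 0 3 * swap 1 2}

-- For a 3-cycle `c`, the conjugates of `c` under the Klein four-group fill its coset of `c`. Both a
-- 3-cycle and its square are needed in `kleinFour_apply`.
set_option maxRecDepth 10000 in
theorem kleinFour_conj : ∀ c ∈ [swap 0 1 * swap 0 2, swap 0 1 * swap 0 2 * (swap 0 1 * swap 0 2)],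
    (∀ a ∈ kleinFour, ∀ b ∈ kleinFour, a * c * a⁻¹ = b * c * b⁻¹ → a = b) ∧
      kleinFour.image (fun s => s * c * s⁻¹) = kleinFour.image (fun s => s * c) := by
  decide

theorem kleinFour_image_mul : ∀ t ∈ kleinFour,
    kleinFour.image (fun s => t * s) = kleinFour.image (fun s => s) := by
  decide

theorem mem_kleinFour_of_commute : ∀ τ : Equiv.Perm (Fin 4), sign τ = 1 →
    τ * (swap 0 1 * swap 2 3) = swap 0 1 * swap 2 3 * τ → τ ∈ kleinFour := by
  decide

variable {α V : Type*} [Fintype α] [DecidableEq α] [AddCommGroup V] [Module ℂ V]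
  {ρ : Representation ℂ (Equiv.Perm α) V}

theorem add_sq_eq_zero_of_isThreeCycle
    (hno : ∀ σ : Equiv.Perm α, σ.IsThreeCycle → ∀ v, ρ σ v = v → v = 0) {σ : Equiv.Perm α}
    (hσ : σ.IsThreeCycle) (v : V) : v + ρ σ v + ρ (σ * σ) v = 0 := by
  refine hno σ hσ _ ?_
  have h3 : σ * (σ * σ) = 1 := by
    have h := pow_orderOf_eq_one σ
    rwa [hσ.orderOf, pow_succ', pow_two] at h
  rw [map_add, map_add, ← Module.End.mul_apply (ρ σ) (ρ (σ * σ)), ← map_mul, h3, map_one,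
    Module.End.one_apply, ← Module.End.mul_apply, ← map_mul]
  abel

/-- If no `3`-cycle has a nonzero fixed vector, then the double transpositions act trivially. -/
theorem kleinFour_apply (hno : ∀ σ : Equiv.Perm α, σ.IsThreeCycle → ∀ v, ρ σ v = v → v = 0)
    (φ : Equiv.Perm (Fin 4) →* Equiv.Perm α) (hφ : (φ (swap 0 1 * swap 0 2)).IsThreeCycle)
    {t : Equiv.Perm (Fin 4)} (ht : t ∈ kleinFour) (v : V) : ρ (φ t) v = v := by
  set c : Equiv.Perm (Fin 4) := swap 0 1 * swap 0 2 with hc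
  have reindex : ∀ f g : Equiv.Perm (Fin 4) → Equiv.Perm (Fin 4), Set.InjOn f kleinFour →
      Set.InjOn g kleinFour → kleinFour.image f = kleinFour.image g →
      ∑ s ∈ kleinFour, ρ (φ (f s)) v = ∑ s ∈ kleinFour, ρ (φ (g s)) v := fun f g hf hg h => by
    rw [← Finset.sum_image (f := fun s => ρ (φ s) v) hf, h, Finset.sum_image hg]
  -- Here `1 + σ + σ² = 0` is summed over the conjugates of `c`, and in `e2` the relation for `c`
  -- itself is summed over its left translates. The 3-cycle terms agree, so the sum over the Klein
  -- four-group acts as `4`. That sum is unchanged by left multiplication by `t`, so `t` acts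
  -- trivially.
  have e1 : ∑ s ∈ kleinFour, (v + ρ (φ (s * c * s⁻¹)) v + ρ (φ (s * (c * c) * s⁻¹)) v) = 0 := by
    refine Finset.sum_eq_zero fun s _ => ?_
    have h1 : (φ (s * c * s⁻¹)).IsThreeCycle := by
      rw [map_mul, map_mul, map_inv, IsThreeCycle, cycleType_conj]; exact hφ
    have h2 := add_sq_eq_zero_of_isThreeCycle hno h1 v
    rwa [← map_mul, show s * c * s⁻¹ * (s * c * s⁻¹) = s * (c * c) * s⁻¹ by group] at h2
  have e2 : ∑ s ∈ kleinFour, (ρ (φ s) v + ρ (φ (s * c)) v + ρ (φ (s * (c * c))) v) = 0 := by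
    refine Finset.sum_eq_zero fun s _ => ?_
    have h2 := congrArg (ρ (φ s)) (add_sq_eq_zero_of_isThreeCycle hno hφ v)
    simpa only [map_mul, Module.End.mul_apply, map_add, map_zero] using h2
  have r1 := reindex (fun s => s * c * s⁻¹) (fun s => s * c)
    (fun a ha b hb h => (kleinFour_conj c (by simp [hc])).1 a ha b hb h)
    (fun a _ b _ h => mul_right_cancel h) (kleinFour_conj c (by simp [hc])).2
  have r2 := reindex (fun s => s * (c * c) * s⁻¹) (fun s => s * (c * c))
    (fun a ha b hb h => (kleinFour_conj (c * c) (by simp [hc])).1 a ha b hb h)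
    (fun a _ b _ h => mul_right_cancel h) (kleinFour_conj (c * c) (by simp [hc])).2
  have r3 := reindex (fun s => t * s) (fun s => s) (fun a _ b _ h => mul_left_cancel h)
    (fun a _ b _ h => h) (kleinFour_image_mul t ht)
  rw [Finset.sum_add_distrib, Finset.sum_add_distrib] at e1 e2
  rw [r1, r2] at e1
  have e3 : ∑ s ∈ kleinFour, ρ (φ s) v = (4 : ℂ) • v := by
    have h4 : ∑ s ∈ kleinFour, v = (4 : ℂ) • v := by
      rw [Finset.sum_const, show kleinFour.card = 4 by decide, ← Nat.cast_smul_eq_nsmul ℂ]; simp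
    rw [← h4]
    rw [add_assoc] at e1 e2
    exact add_right_cancel (e2.trans e1.symm)
  simp only [map_mul, Module.End.mul_apply] at r3
  rw [← map_sum, e3, map_smul] at r3
  exact smul_right_injective V (by norm_num : (4 : ℂ) ≠ 0) r3

/-- In degree at least five, some `3`-cycle has a nonzero fixed vector. -/
theorem exists_isThreeCycle_fixed [Nontrivial V] (hα : 5 ≤ Fintype.card α) :
    ∃ σ : Equiv.Perm α, σ.IsThreeCycle ∧ ∃ v ≠ 0, ρ σ v = v := by
  by_contra! hno
  replace hno : ∀ σ : Equiv.Perm α, σ.IsThreeCycle → ∀ v, ρ σ v = v → v = 0 := fun σ hσ v hv =>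
    by_contra fun h0 => hno σ hσ v h0 hv
  obtain ⟨e⟩ : Nonempty (Fin 5 ↪ α) := Function.Embedding.nonempty_of_card_le (by simpa using hα)
  have key : ∀ (f : Fin 4 ↪ α) (v : V), ρ (swap (f 0) (f 1) * swap (f 2) (f 3)) v = v := by
    intro f v
    have hswap : ∀ i j, viaEmbeddingHom f (swap i j) = swap (f i) (f j) := fun i j => by
      rw [viaEmbeddingHom_apply]
      ext x
      by_cases hx : x ∈ Set.range f
      · obtain ⟨k, rfl⟩ := hx
        rw [viaEmbedding_apply, Equiv.swap_apply_def, Equiv.swap_apply_def]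
        simp only [f.injective.eq_iff]
        split_ifs <;> rfl
      · rw [viaEmbedding_apply_of_notMem _ _ _ hx, Equiv.swap_apply_of_ne_of_ne]
        · rintro rfl; exact hx ⟨_, rfl⟩
        · rintro rfl; exact hx ⟨_, rfl⟩
    have h1 := kleinFour_apply hno (viaEmbeddingHom f) (by
      rw [map_mul, hswap, hswap]
      exact isThreeCycle_swap_mul_swap_same (by simp) (by simp) (by simp))
      (t := swap 0 1 * swap 2 3) (by decide) v
    rwa [map_mul, hswap, hswap] at h1
  obtain ⟨v, hv⟩ := exists_ne (0 : V)
  have k1 := key ((Fin.castLEEmb (by norm_num : 4 ≤ 5)).trans e) v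
  have k2 := key (Function.Embedding.trans ⟨![0, 1, 2, 4], by decide⟩ e) v
  refine hv (hno (swap (e 2) (e 3) * swap (e 2) (e 4))
    (isThreeCycle_swap_mul_swap_same (by simp) (by simp) (by simp)) v ?_)
  -- Two double transpositions sharing a transposition multiply to a 3-cycle, which would therefore
  -- act trivially.
  have h1 : swap (e 2) (e 3) * swap (e 2) (e 4) =
      (swap (e 0) (e 1) * swap (e 2) (e 3))⁻¹ * (swap (e 0) (e 1) * swap (e 2) (e 4)) := by
    simp [mul_assoc]
  change ρ (swap (e 0) (e 1) * swap (e 2) (e 3)) v = v at k1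
  change ρ (swap (e 0) (e 1) * swap (e 2) (e 4)) v = v at k2
  rw [h1, map_mul, Module.End.mul_apply, k2, ← zpow_neg_one]
  exact zpow_apply_of_fixed k1 _

/-- Either a 3-cycle has a fixed vector, or the Klein four-group acts trivially. In the latter case
a double transposition serves as `g`, since its even centralizer is that group. -/
theorem exists_fixedByEvenCentralizer_of_card_eq_four [Nontrivial V] (hα : Fintype.card α = 4) :
    ∃ g, sign g = 1 ∧ FixedByEvenCentralizer ρ g := by
  by_cases hno : ∀ σ : Equiv.Perm α, σ.IsThreeCycle → ∀ v, ρ σ v = v → v = 0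
  · obtain ⟨e⟩ : Nonempty (Fin 4 ≃ α) := ⟨(finCongr hα.symm).trans (Fintype.equivFin α).symm⟩
    let φ : Equiv.Perm (Fin 4) →* Equiv.Perm α := MonoidHom.mk' e.permCongr (by intros; ext; simp)
    have hφ : ∀ σ, φ σ = e.permCongr σ := fun _ => rfl
    obtain ⟨v, hv⟩ := exists_ne (0 : V)
    refine ⟨φ (swap 0 1 * swap 2 3), ?_, v, hv, fun τ hτ hcomm => ?_⟩
    · rw [hφ, sign_permCongr]; decide
    · obtain ⟨t, rfl⟩ := e.permCongr.surjective τ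
      rw [sign_permCongr] at hτ
      refine kleinFour_apply hno φ ?_ (mem_kleinFour_of_commute t hτ ?_) v
      · have hswap : ∀ i j, φ (swap i j) = swap (e i) (e j) := fun i j => by
          rw [hφ, Equiv.permCongr_def, Equiv.symm_trans_swap_trans]
        rw [map_mul, hswap, hswap]
        exact isThreeCycle_swap_mul_swap_same (by simp) (by simp) (by simp)
      · have h := hcomm.eq
        rw [← hφ, ← map_mul, ← map_mul] at h
        exact e.permCongr.injective h
  · push Not at hno
    obtain ⟨σ, hσ, v, hv, hv0⟩ := hno
    exact ⟨σ, hσ.sign, fixedByEvenCentralizer_of_isCycle hσ.isCycle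
      (by rw [hσ.card_support]; decide) (by rw [hσ.card_support]; omega) hv0 hv⟩

end KleinFour

/-! ### Induction on the degree by Bertrand's postulate. -/

theorem Nat.exists_prime_half_lt {n : ℕ} (hn : 6 ≤ n) :
    ∃ p, p.Prime ∧ 5 ≤ p ∧ p < n ∧ n < 2 * p ∧ (n = p + 3 → 7 ≤ p) := by
  -- For `n = 8` the prime 5 would leave remainder 3 with `p - 2 = 3`, repeating a cycle length; 7
  -- avoids this.
  by_cases h8 : n = 8
  · exact ⟨7, by norm_num, by omega⟩
  obtain ⟨p, hp, h1, h2⟩ := Nat.exists_prime_lt_and_le_two_mul (n / 2) (by omega)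
  have hodd := Nat.odd_iff.mp (hp.odd_of_ne_two (by omega))
  have h5 : p ≠ 4 := by rintro rfl; omega
  exact ⟨p, hp, by omega, by omega, by omega, by omega⟩

/-- Every nonzero representation of the symmetric group of degree `n ≠ 3` has a nonzero vector
fixed by the centralizer, in the alternating group, of some even permutation. -/
theorem exists_fixedByEvenCentralizer (n : ℕ) (hn : n ≠ 3) :
    ∀ {α V : Type*} [Fintype α] [DecidableEq α] [AddCommGroup V] [Module ℂ V]
      [FiniteDimensional ℂ V] [Nontrivial V] (ρ : Representation ℂ (Equiv.Perm α) V),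
      Fintype.card α = n → ∃ g, sign g = 1 ∧ FixedByEvenCentralizer ρ g := by
  induction n using Nat.strong_induction_on with
  | _ n ih =>
  intro α V _ _ _ _ _ _ ρ hα
  by_cases h2 : n ≤ 2
  · exact ⟨1, map_one _, fixedByEvenCentralizer_of_card_le_two (by omega) 1⟩
  by_cases h4 : n = 4
  · exact exists_fixedByEvenCentralizer_of_card_eq_four (by omega)
  by_cases h5 : n = 5
  · obtain ⟨σ, hσ, v, hv, hv0⟩ := exists_isThreeCycle_fixed (ρ := ρ) (by omega)
    exact ⟨σ, hσ.sign, fixedByEvenCentralizer_of_isCycle hσ.isCycle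
      (by rw [hσ.card_support]; decide) (by rw [hσ.card_support]; omega) hv hv0⟩
  obtain ⟨p, hp, hp5, hpn, hnp, h3⟩ := Nat.exists_prime_half_lt (show 6 ≤ n by omega)
  have hpodd := hp.odd_of_ne_two (by omega)
  -- The induction hypothesis is missing in degree 3. There a 3-cycle is split off first, and the
  -- remaining `p` letters carry a cycle of length `p` or `p - 2`, at least 5 since `p ≥ 7`.
  by_cases hn3 : n = p + 3
  · obtain ⟨c, hc, v, hv, hv0⟩ := exists_isThreeCycle_fixed (ρ := ρ) (by omega)
    have := nontrivial_fixedSubmodule hv hv0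
    have hcard : Fintype.card {x // x ∉ c.support} = p := by
      rw [card_notMem_support, hc.card_support]; omega
    obtain ⟨σ, hσ, hσp, w, hw, hw0⟩ := exists_fixed_of_prime_card (fixedRep ρ c) hp hp5 hcard
    have hσodd : Odd σ.support.card := by
      rcases hσp with h | h <;> rw [h]
      exacts [hpodd, Nat.Odd.sub_even (by omega) hpodd even_two]
    have hfix := fixedByEvenCentralizer_of_isCycle hσ hσodd (by omega) hw hw0
    refine ⟨_, ?_, hfix.mul_ofSubtype hc.isCycle (by rw [hc.card_support]; decide) ?_⟩
    · rw [map_mul, hc.sign, sign_ofSubtype, hσ.sign, hσodd.neg_one_pow]; rfl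
    · rw [hσ.cycleType, hc.card_support, Multiset.mem_singleton]
      have := h3 hn3
      omega
  · obtain ⟨c, hc, hcp, v, hv, hv0⟩ := exists_fixed_of_prime_lt_card ρ hp hp5 (by omega)
    have := nontrivial_fixedSubmodule hv hv0
    have hcard : Fintype.card {x // x ∉ c.support} = n - p := by
      rw [card_notMem_support, hcp, hα]
    obtain ⟨h, hh, hfix⟩ := ih (n - p) (by omega) (by omega) (fixedRep ρ c) hcard
    refine ⟨_, ?_, hfix.mul_ofSubtype hc (by rwa [hcp]) fun hmem => ?_⟩
    · rw [map_mul, hc.sign, sign_ofSubtype, hh, hcp, hpodd.neg_one_pow]; rfl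
    -- The remaining `n - p < p` letters leave no room for a second `p`-cycle.
    · have h6 := Multiset.le_sum_of_mem hmem
      have h7 := h.support.card_le_univ
      rw [sum_cycleType] at h6
      omega
end
-- The induced representation: sign twist, decomposition and degree.
noncomputable section

open Equiv (swap)
open Equiv.Perm
open scoped TensorProduct

namespace Representation

section Ind

variable {k G H A W : Type*} [CommRing k] [Group G] [Group H] (φ : G →* H)
  [AddCommGroup A] [Module k A] (ρ : Representation k G A) [AddCommGroup W] [Module k W]

theorem IndV.mk_mul (g : G) (h : H) (a : A) : IndV.mk φ ρ (φ g * h) (ρ g a) = IndV.mk φ ρ h a := by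
  have := Coinvariants.mk_self_apply ((Representation.tprod ((leftRegular k H).comp φ) ρ)) g
    (MonoidAlgebra.single h 1 ⊗ₜ a)
  simpa using this

/-- The linear map out of an induced representation given by a compatible family of maps. -/
def IndV.desc (f : H → A →ₗ[k] W) (hf : ∀ g h a, f (φ g * h) (ρ g a) = f h a) :
    IndV φ ρ →ₗ[k] W :=
  Coinvariants.lift _ (TensorProduct.lift (Finsupp.linearCombination k f ∘ₗ
    (MonoidAlgebra.coeffLinearEquiv k).toLinearMap)) fun g => by
      ext h a
      simp [hf]

@[simp]
theorem IndV.desc_mk (f : H → A →ₗ[k] W) (hf : ∀ g h a, f (φ g * h) (ρ g a) = f h a) (h : H)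
    (a : A) : IndV.desc φ ρ f hf (IndV.mk φ ρ h a) = f h a := by
  simp [IndV.desc]

end Ind

theorem finiteDimensional_of_isIrreducible {k G V : Type*} [Field k] [Group G] [Finite G]
    [AddCommGroup V] [Module k V] (ρ : Representation k G V) (h : ρ.IsIrreducible) :
    FiniteDimensional k V := by
  have : Module.Finite k ρ.asModule := Module.Finite.trans (MonoidAlgebra k G) ρ.asModule
  exact this

end Representation

open Representation

section

variable {n : ℕ}

theorem conjRepOn_single {G : Type*} [Group G] (H : Subgroup G) [H.Normal] (g : G) (x : H)
    (c : ℂ) : conjRepOn H g (MonoidAlgebra.single x c) =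
      MonoidAlgebra.single (MulAut.conjNormal g x) c := by
  simp [conjRepOn]

/-- The representation being induced is a restriction; this is what makes the maps `h ⊗ a ↦ ε(h)
h⁻¹a` well defined. -/
theorem conjRep_eq {G : Type*} [Group G] (H : Subgroup G) [H.Normal] (h : H) :
    conjRep H h = conjRepOn H (h : G) := by
  ext x : 2
  simp only [LinearMap.comp_apply, MonoidAlgebra.lsingle_apply, conjRepOn_single]
  simp only [conjRep, MonoidHom.comp_apply, ofMulAction_single]
  rfl

theorem omegaRep_tmul {V : Type*} [AddCommGroup V] [Module ℂ V]
    (ρ : Representation ℂ (Equiv.Perm (Fin n)) V) (σ : Equiv.Perm (Fin n)) (c : ℂ) (v : V) :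
    omegaRep ρ σ (c ⊗ₜ v) = (((sign σ : ℤ) : ℂ) * c) ⊗ₜ ρ σ v := by
  simp [omegaRep, signRep]

/-- Multiplication by the sign on `ℂ[Sₙ]` descends to the induced representation. -/
def signTwist (n : ℕ) : IndV (alternatingGroup (Fin n)).subtype
      (conjRep (alternatingGroup (Fin n))) →ₗ[ℂ] IndV (alternatingGroup (Fin n)).subtype
      (conjRep (alternatingGroup (Fin n))) :=
  IndV.desc _ _ (fun h => ((sign h : ℤ) : ℂ) • IndV.mk _ _ h) fun g h a => by
    have hg : sign (g : Equiv.Perm (Fin n)) = 1 := mem_alternatingGroup.mp g.2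
    rw [LinearMap.smul_apply, LinearMap.smul_apply, IndV.mk_mul]
    simp [hg]

theorem sign_mul_self_cast (h : Equiv.Perm (Fin n)) :
    ((sign h : ℤ) : ℂ) * ((sign h : ℤ) : ℂ) = 1 := by
  rw [← Int.cast_mul, ← Units.val_mul, Int.units_mul_self]; simp

theorem signTwist_mk (h : Equiv.Perm (Fin n)) (a) :
    signTwist n (IndV.mk _ _ h a) = ((sign h : ℤ) : ℂ) • IndV.mk _ _ h a := by
  rw [signTwist, IndV.desc_mk]; rfl

theorem signTwist_signTwist : signTwist n ∘ₗ signTwist n = LinearMap.id := by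
  refine IndV.hom_ext _ _ fun h => LinearMap.ext fun a => ?_
  simp only [LinearMap.comp_apply (g := IndV.mk _ _ h), LinearMap.comp_apply (f := signTwist n)]
  rw [signTwist_mk, map_smul, signTwist_mk, smul_smul, sign_mul_self_cast, one_smul]; rfl

/-- `signTwist` as a linear equivalence. -/
def signTwistEquiv (n : ℕ) : IndV (alternatingGroup (Fin n)).subtype
      (conjRep (alternatingGroup (Fin n))) ≃ₗ[ℂ] IndV (alternatingGroup (Fin n)).subtype
      (conjRep (alternatingGroup (Fin n))) :=
  LinearEquiv.ofLinearMap (signTwist n) (signTwist n) signTwist_signTwist signTwist_signTwist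

theorem nonempty_equiv_omegaRep_inducedConjAlternating (n : ℕ) :
    Nonempty ((inducedConjAlternating n).Equiv (omegaRep (inducedConjAlternating n))) := by
  refine ⟨Representation.Equiv.mk ((signTwistEquiv n).trans (TensorProduct.lid ℂ _).symm) fun g => ?_⟩
  refine IndV.hom_ext _ _ fun h => LinearMap.ext fun a => ?_
  have h1 (b) : inducedConjAlternating n g (IndV.mk _ _ h b) = IndV.mk _ _ (h * g⁻¹) b :=
    ind_mk _ _ g h b
  change (TensorProduct.lid ℂ _).symm (signTwist n (inducedConjAlternating n g (IndV.mk _ _ h a))) =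
    omegaRep (inducedConjAlternating n) g
      ((TensorProduct.lid ℂ _).symm (signTwist n (IndV.mk _ _ h a)))
  rw [h1, signTwist_mk, signTwist_mk, TensorProduct.lid_symm_apply, TensorProduct.lid_symm_apply,
    omegaRep_tmul, map_smul, h1, TensorProduct.tmul_smul, TensorProduct.tmul_smul,
    ← smul_eq_mul ((sign g : ℤ) : ℂ) 1, ← TensorProduct.smul_tmul', smul_smul]
  simp

/-- `h ⊗ a ↦ ε(h) h⁻¹a`, for a function `ε` on the symmetric group invariant under left
multiplication by even permutations. -/
def indToConjOn (ε : Equiv.Perm (Fin n) → ℂ)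
    (hε : ∀ (g : alternatingGroup (Fin n)) h, ε (g * h) = ε h) :
    IndV (alternatingGroup (Fin n)).subtype (conjRep (alternatingGroup (Fin n))) →ₗ[ℂ]
      MonoidAlgebra ℂ (alternatingGroup (Fin n)) :=
  IndV.desc _ _ (fun h => ε h • conjRepOn (alternatingGroup (Fin n)) h⁻¹) fun g h a => by
    rw [LinearMap.smul_apply, LinearMap.smul_apply, conjRep_eq, ← Module.End.mul_apply, ← map_mul]
    simp [hε]

theorem indToConjOn_mk (ε : Equiv.Perm (Fin n) → ℂ) (hε) (h : Equiv.Perm (Fin n)) (a) :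
    indToConjOn ε hε (IndV.mk _ _ h a) = ε h • conjRepOn (alternatingGroup (Fin n)) h⁻¹ a := by
  rw [indToConjOn, IndV.desc_mk]; rfl

theorem mk_conjRepOn {g h : Equiv.Perm (Fin n)} (hg : sign g = 1) (a) :
    IndV.mk (alternatingGroup (Fin n)).subtype (conjRep (alternatingGroup (Fin n))) (g * h)
      (conjRepOn (alternatingGroup (Fin n)) g a) = IndV.mk _ _ h a := by
  have := IndV.mk_mul (alternatingGroup (Fin n)).subtype (conjRep (alternatingGroup (Fin n)))
    ⟨g, mem_alternatingGroup.mpr hg⟩ h a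
  rwa [conjRep_eq] at this

theorem sign_alternating_mul (g : alternatingGroup (Fin n)) (h : Equiv.Perm (Fin n)) :
    ((sign ((g : Equiv.Perm (Fin n)) * h) : ℤ) : ℂ) = ((sign h : ℤ) : ℂ) := by
  rw [map_mul, show sign (g : Equiv.Perm (Fin n)) = 1 from mem_alternatingGroup.mp g.2, one_mul]

/-- The comparison map to the conjugation representation and its sign twist. -/
def indToProd (n : ℕ) :
    IndV (alternatingGroup (Fin n)).subtype (conjRep (alternatingGroup (Fin n))) →ₗ[ℂ]
      MonoidAlgebra ℂ (alternatingGroup (Fin n)) ×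
        (ℂ ⊗[ℂ] MonoidAlgebra ℂ (alternatingGroup (Fin n))) :=
  (indToConjOn (fun _ => 1) fun _ _ => rfl).prod
    ((TensorProduct.lid ℂ _).symm.toLinearMap ∘ₗ
      indToConjOn (fun h => ((sign h : ℤ) : ℂ)) sign_alternating_mul)

theorem indToProd_mk (h : Equiv.Perm (Fin n)) (a) :
    indToProd n (IndV.mk _ _ h a) = (conjRepOn (alternatingGroup (Fin n)) h⁻¹ a,
      ((sign h : ℤ) : ℂ) ⊗ₜ conjRepOn (alternatingGroup (Fin n)) h⁻¹ a) := by
  change (indToConjOn (fun _ => 1) (fun _ _ => rfl) (IndV.mk _ _ h a), (TensorProduct.lid ℂ _).symm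
    (indToConjOn (fun h => ((sign h : ℤ) : ℂ)) sign_alternating_mul (IndV.mk _ _ h a))) = _
  rw [indToConjOn_mk, indToConjOn_mk, one_smul, TensorProduct.lid_symm_apply,
    TensorProduct.tmul_smul, TensorProduct.smul_tmul', smul_eq_mul, mul_one]

/-- The inverse of the comparison map, for an odd permutation `t`. -/
def prodToInd (t : Equiv.Perm (Fin n)) :
    MonoidAlgebra ℂ (alternatingGroup (Fin n)) ×
        (ℂ ⊗[ℂ] MonoidAlgebra ℂ (alternatingGroup (Fin n))) →ₗ[ℂ]
      IndV (alternatingGroup (Fin n)).subtype (conjRep (alternatingGroup (Fin n))) :=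
  (2⁻¹ : ℂ) • (IndV.mk _ _ 1 ∘ₗ
      (LinearMap.coprod LinearMap.id (TensorProduct.lid ℂ _).toLinearMap) +
    IndV.mk _ _ t ∘ₗ conjRepOn (alternatingGroup (Fin n)) t ∘ₗ
      (LinearMap.coprod LinearMap.id (-(TensorProduct.lid ℂ _).toLinearMap)))

theorem prodToInd_apply (t : Equiv.Perm (Fin n)) (x) (c : ℂ) (y) :
    prodToInd t (x, c ⊗ₜ y) = (2⁻¹ : ℂ) • (IndV.mk _ _ 1 (x + c • y) +
      IndV.mk _ _ t (conjRepOn (alternatingGroup (Fin n)) t (x - c • y))) := by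
  have h1 : TensorProduct.lid ℂ (MonoidAlgebra ℂ (alternatingGroup (Fin n))) (c ⊗ₜ y) = c • y :=
    TensorProduct.lid_tmul _ _
  rw [← h1, sub_eq_add_neg]
  rfl

theorem conjRepOn_inv_apply_self (t : Equiv.Perm (Fin n)) (x) :
    conjRepOn (alternatingGroup (Fin n)) t⁻¹ (conjRepOn (alternatingGroup (Fin n)) t x) = x := by
  rw [← Module.End.mul_apply, ← map_mul]; simp

/-- The induced representation is the sum of the conjugation representation on the even
permutations and its sign twist. -/
def inducedConjAlternatingEquiv (t : Equiv.Perm (Fin n)) (ht : sign t = -1) :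
    (inducedConjAlternating n).Equiv ((conjRepOn (alternatingGroup (Fin n))).prod
      (omegaRep (conjRepOn (alternatingGroup (Fin n))))) :=
  Representation.Equiv.mk (LinearEquiv.ofLinearMap (indToProd n) (prodToInd t)
    (by
      refine LinearMap.prod_ext (LinearMap.ext fun x => ?_) (TensorProduct.ext' fun c y => ?_)
      · change indToProd n (prodToInd t (x, 0)) = (x, 0)
        rw [← TensorProduct.tmul_zero _ (1 : ℂ), prodToInd_apply, map_smul, map_add, indToProd_mk,
          indToProd_mk, conjRepOn_inv_apply_self, ht]
        simp [TensorProduct.neg_tmul, ← two_smul ℂ x]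
      · change indToProd n (prodToInd t (0, c ⊗ₜ y)) = (0, c ⊗ₜ y)
        rw [prodToInd_apply, map_smul, map_add, indToProd_mk,
          indToProd_mk, conjRepOn_inv_apply_self, ht]
        simp [TensorProduct.neg_tmul, TensorProduct.tmul_neg, ← two_smul ℂ]
        rw [TensorProduct.smul_tmul']; simp)
    (by
      refine IndV.hom_ext _ _ fun h => LinearMap.ext fun a => ?_
      change prodToInd t (indToProd n (IndV.mk _ _ h a)) = IndV.mk _ _ h a
      rw [indToProd_mk, prodToInd_apply]
      -- The cosets of `A_n` are represented by `1` and `t`; the sign of `h` decides which of the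
      -- two terms of `prodToInd` survives.
      rcases Int.units_eq_one_or (sign h) with hs | hs
      · have h1 := mk_conjRepOn (g := h⁻¹) (h := h) (by simpa using hs) a
        rw [inv_mul_cancel] at h1
        simp only [hs, Units.val_one, Int.cast_one, one_smul, sub_self, map_zero, add_zero, map_add]
        rw [h1, ← two_smul ℂ, smul_smul]; simp
      · have h1 := mk_conjRepOn (g := t * h⁻¹) (h := h) (by simp [hs, ht]) a
        rw [inv_mul_cancel_right, map_mul, Module.End.mul_apply] at h1
        simp only [hs, Units.val_neg, Units.val_one, Int.cast_neg, Int.cast_one, neg_smul, one_smul,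
          add_neg_cancel, map_zero, zero_add, sub_neg_eq_add, map_add]
        rw [h1, ← two_smul ℂ, smul_smul]; simp))
    fun g => by
      refine IndV.hom_ext _ _ fun h => LinearMap.ext fun a => ?_
      have h1 : inducedConjAlternating n g (IndV.mk _ _ h a) = IndV.mk _ _ (h * g⁻¹) a :=
        ind_mk _ _ g h a
      change indToProd n (inducedConjAlternating n g (IndV.mk _ _ h a)) =
        ((conjRepOn (alternatingGroup (Fin n))).prod
          (omegaRep (conjRepOn (alternatingGroup (Fin n))))) g (indToProd n (IndV.mk _ _ h a))
      rw [h1, indToProd_mk, indToProd_mk]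
      simp [Representation.prod, omegaRep_tmul, mul_comm]

theorem exists_sign_eq_neg_one (hn : 2 ≤ n) : ∃ t : Equiv.Perm (Fin n), sign t = -1 :=
  ⟨swap ⟨0, by omega⟩ ⟨1, by omega⟩, sign_swap (by simp)⟩

theorem finrank_inducedConjAlternating (n : ℕ) :
    Module.finrank ℂ (IndV (alternatingGroup (Fin n)).subtype
      (conjRep (alternatingGroup (Fin n)))) = n.factorial := by
  have hM : Module.finrank ℂ (MonoidAlgebra ℂ (alternatingGroup (Fin n))) =
      Fintype.card (alternatingGroup (Fin n)) := by
    rw [(MonoidAlgebra.coeffLinearEquiv ℂ).finrank_eq, Module.finrank_finsupp_self]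
  by_cases hn : 2 ≤ n
  · obtain ⟨t, ht⟩ := exists_sign_eq_neg_one hn
    have : Nontrivial (Fin n) := Fin.nontrivial_iff_two_le.mpr hn
    rw [(inducedConjAlternatingEquiv t ht).toLinearEquiv.finrank_eq, Module.finrank_prod,
      (TensorProduct.lid ℂ _).finrank_eq, hM, ← two_mul, two_mul_card_alternatingGroup,
      Fintype.card_perm, Fintype.card_fin]
  -- For `n ≤ 1` there is no odd permutation; the group is trivial and induction changes nothing.
  · have hsub : Subsingleton (Fin n) := Fin.subsingleton_iff_le_one.mpr (by omega)
    have h1 : ∀ h : Equiv.Perm (Fin n), h = 1 := fun h => Subsingleton.elim _ _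
    let E : IndV (alternatingGroup (Fin n)).subtype (conjRep (alternatingGroup (Fin n))) ≃ₗ[ℂ]
        MonoidAlgebra ℂ (alternatingGroup (Fin n)) :=
      LinearEquiv.ofLinearMap (indToConjOn (fun _ => 1) fun _ _ => rfl) (IndV.mk _ _ 1)
        (LinearMap.ext fun a => by
          change indToConjOn (fun _ => 1) (fun _ _ => rfl) (IndV.mk _ _ 1 a) = a
          rw [indToConjOn_mk]; simp)
        (IndV.hom_ext _ _ fun h => LinearMap.ext fun a => by
          change IndV.mk _ _ 1
            (indToConjOn (fun _ => 1) (fun _ _ => rfl) (IndV.mk _ _ h a)) = IndV.mk _ _ h a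
          rw [indToConjOn_mk, h1 h]; simp)
    rw [E.finrank_eq, hM, Fintype.card_eq_one_iff.mpr ⟨1, fun x => Subtype.ext (h1 _)⟩]
    interval_cases n <;> rfl

end
end
-- Embedding irreducible representations.
noncomputable section

open Equiv (swap)
open Equiv.Perm
open scoped TensorProduct
open Representation

section

variable {n : ℕ} {V : Type*} [AddCommGroup V] [Module ℂ V]
  (ρ : Representation ℂ (Equiv.Perm (Fin n)) V)

/-- The map `x ↦ ∑ₛ ε(s) ℓ(s⁻¹ x) s g s⁻¹` to the span of the even permutations. -/
def conjSum (ε : Equiv.Perm (Fin n) →* ℤˣ) (ℓ : Module.Dual ℂ V) (g : alternatingGroup (Fin n)) :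
    V →ₗ[ℂ] MonoidAlgebra ℂ (alternatingGroup (Fin n)) :=
  ∑ s, ((ε s : ℤ) : ℂ) • (MonoidAlgebra.lsingle (MulAut.conjNormal s g) ∘ₗ ℓ ∘ₗ ρ s⁻¹)

theorem conjSum_apply (ε : Equiv.Perm (Fin n) →* ℤˣ) (ℓ : Module.Dual ℂ V)
    (g : alternatingGroup (Fin n)) (x : V) :
    conjSum ρ ε ℓ g x =
      ∑ s, ((ε s : ℤ) : ℂ) • MonoidAlgebra.single (MulAut.conjNormal s g) (ℓ (ρ s⁻¹ x)) := by
  simp [conjSum]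

theorem conjSum_apply_apply (ε : Equiv.Perm (Fin n) →* ℤˣ) (ℓ : Module.Dual ℂ V)
    (g : alternatingGroup (Fin n)) (u : Equiv.Perm (Fin n)) (x : V) :
    conjSum ρ ε ℓ g (ρ u x) =
      ((ε u : ℤ) : ℂ) • conjRepOn (alternatingGroup (Fin n)) u (conjSum ρ ε ℓ g x) := by
  rw [conjSum_apply, conjSum_apply, map_sum, Finset.smul_sum,
    ← Equiv.sum_comp (Equiv.mulLeft u)]
  refine Finset.sum_congr rfl fun s _ => ?_
  rw [map_smul, conjRepOn_single, smul_smul, Equiv.coe_mulLeft, ← MulAut.mul_apply, ← map_mul,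
    ← Module.End.mul_apply, ← map_mul, map_mul ε]
  simp

theorem coeff_conjSum (ε : Equiv.Perm (Fin n) →* ℤˣ) (ℓ : Module.Dual ℂ V)
    (g : alternatingGroup (Fin n)) (x : V) :
    (conjSum ρ ε ℓ g x).coeff g =
      ∑ s : Equiv.Perm (Fin n), if s * g = g * s then ((ε s : ℤ) : ℂ) * ℓ (ρ s⁻¹ x) else 0 := by
  have h1 : (conjSum ρ ε ℓ g x).coeff g =
      (Finsupp.lapply g ∘ₗ (MonoidAlgebra.coeffLinearEquiv (S := ℂ) (M := alternatingGroup (Fin n))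
        ℂ).toLinearMap) (conjSum ρ ε ℓ g x) :=
    rfl
  rw [h1, conjSum_apply, map_sum]
  refine Finset.sum_congr rfl fun s _ => ?_
  have h2 : MulAut.conjNormal s g = g ↔ s * g = g * s := by
    rw [Subtype.ext_iff, MulAut.conjNormal_apply, mul_inv_eq_iff_eq_mul]
  simp [Finsupp.single_apply, h2]
  exact fun h h' => absurd h' h

/-- In the sum of the two coefficients at `g`, odd elements of the centralizer of `g` cancel. Each
even one contributes `2 ℓ(v)`, and the identity is among these. -/
theorem exists_conjSum_ne_zero {g : alternatingGroup (Fin n)} {v : V} {ℓ : Module.Dual ℂ V}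
    (hℓ : ℓ v ≠ 0) (hfix : ∀ τ : Equiv.Perm (Fin n), sign τ = 1 → Commute τ g → ρ τ v = v) :
    conjSum ρ 1 ℓ g ≠ 0 ∨ conjSum ρ sign ℓ g ≠ 0 := by
  by_contra! h
  have h1 := coeff_conjSum ρ 1 ℓ g v
  have h2 := coeff_conjSum ρ sign ℓ g v
  rw [h.1] at h1
  rw [h.2] at h2
  have h3 : ∑ s : Equiv.Perm (Fin n),
      (if s * g = g * s ∧ sign s = 1 then 2 * ℓ v else 0) = 0 := by
    rw [LinearMap.zero_apply, MonoidAlgebra.coeff_zero, Finsupp.zero_apply] at h1 h2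
    refine Eq.trans ?_ ((congrArg₂ HAdd.hAdd h1 h2).symm.trans (add_zero 0))
    rw [← Finset.sum_add_distrib]
    refine Finset.sum_congr rfl fun s _ => ?_
    by_cases hs : s * g = g * s
    · rcases Int.units_eq_one_or (sign s) with hs' | hs'
      · simp [hs, hs', hfix s⁻¹ (by simp [hs']) (Commute.inv_left hs), two_mul]
      · simp [hs, hs']
    · simp [hs]
  rw [← Finset.sum_filter, Finset.sum_const, nsmul_eq_mul] at h3
  simp only [mul_eq_zero, Nat.cast_eq_zero, Finset.card_eq_zero, hℓ, OfNat.ofNat_ne_zero,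
    or_false] at h3
  have : (1 : Equiv.Perm (Fin n)) ∈ Finset.univ.filter fun s : Equiv.Perm (Fin n) =>
      s * g = g * s ∧ sign s = 1 := by simp
  rw [h3] at this
  simp at this

/-- The sum of `conjSum` for the trivial and the sign character, as an intertwining map. -/
def conjSumIntertwining (ℓ : Module.Dual ℂ V) (g : alternatingGroup (Fin n)) :
    ρ.IntertwiningMap ((conjRepOn (alternatingGroup (Fin n))).prod
      (omegaRep (conjRepOn (alternatingGroup (Fin n))))) :=
  ⟨(conjSum ρ 1 ℓ g).prod ((TensorProduct.lid ℂ _).symm.toLinearMap ∘ₗ conjSum ρ sign ℓ g),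
    fun u => LinearMap.ext fun x => by
      change (conjSum ρ 1 ℓ g (ρ u x), (1 : ℂ) ⊗ₜ conjSum ρ sign ℓ g (ρ u x)) =
        (conjRepOn _ u (conjSum ρ 1 ℓ g x), omegaRep _ u ((1 : ℂ) ⊗ₜ conjSum ρ sign ℓ g x))
      rw [conjSum_apply_apply, conjSum_apply_apply, omegaRep_tmul, TensorProduct.tmul_smul,
        TensorProduct.smul_tmul']
      simp⟩

theorem conjSumIntertwining_ne_zero {g : alternatingGroup (Fin n)} {v : V} {ℓ : Module.Dual ℂ V}
    (hℓ : ℓ v ≠ 0) (hfix : ∀ τ : Equiv.Perm (Fin n), sign τ = 1 → Commute τ g → ρ τ v = v) :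
    conjSumIntertwining ρ ℓ g ≠ 0 := by
  intro h0
  have h1 (x : V) : (conjSum ρ 1 ℓ g x, (TensorProduct.lid ℂ _).symm (conjSum ρ sign ℓ g x)) = 0 :=
    DFunLike.congr_fun h0 x
  rcases exists_conjSum_ne_zero ρ hℓ hfix with h | h
  · exact h (LinearMap.ext fun x => congrArg Prod.fst (h1 x))
  · exact h (LinearMap.ext fun x => by simpa using congrArg Prod.snd (h1 x))

theorem exists_injective_intertwiningMap (hn : n ≠ 3) (hρ : ρ.IsIrreducible) :
    ∃ f : ρ.IntertwiningMap (inducedConjAlternating n), Function.Injective f := by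
  have := finiteDimensional_of_isIrreducible ρ hρ
  have hV : Nontrivial V := by
    by_contra hV
    rw [not_nontrivial_iff_subsingleton] at hV
    exact bot_ne_top (α := Subrepresentation ρ) (SetLike.ext fun x => by
      rw [Subsingleton.elim x 0]; exact iff_of_true (⊥ : Subrepresentation ρ).toSubmodule.zero_mem
        (⊤ : Subrepresentation ρ).toSubmodule.zero_mem)
  by_cases h2 : 2 ≤ n
  · obtain ⟨t, ht⟩ := exists_sign_eq_neg_one h2
    obtain ⟨g, hg, v, hv, hfix⟩ := exists_fixedByEvenCentralizer n hn ρ (Fintype.card_fin n)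
    obtain ⟨ℓ, hℓ⟩ : ∃ ℓ : Module.Dual ℂ V, ℓ v ≠ 0 := by
      by_contra! h
      exact hv ((Module.forall_dual_apply_eq_zero_iff ℂ v).mp h)
    let f := conjSumIntertwining ρ ℓ ⟨g, mem_alternatingGroup.mpr hg⟩
    have hf : Function.Injective f := (IsIrreducible.injective_or_eq_zero f).resolve_right
      (conjSumIntertwining_ne_zero ρ hℓ hfix)
    let E := (inducedConjAlternatingEquiv t ht).symm
    exact ⟨E.toIntertwiningMap.comp f, E.toLinearEquiv.injective.comp hf⟩
  -- For a trivial group every linear map intertwines, so a nonzero map of rank one suffices.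
  · have : Subsingleton (Fin n) := Fin.subsingleton_iff_le_one.mpr (by omega)
    have h1 : ∀ h : Equiv.Perm (Fin n), h = 1 := fun h => Subsingleton.elim _ _
    obtain ⟨v, hv⟩ := exists_ne (0 : V)
    obtain ⟨ℓ, hℓ⟩ : ∃ ℓ : Module.Dual ℂ V, ℓ v ≠ 0 := by
      by_contra! h
      exact hv ((Module.forall_dual_apply_eq_zero_iff ℂ v).mp h)
    have : Nontrivial (IndV (alternatingGroup (Fin n)).subtype
        (conjRep (alternatingGroup (Fin n)))) := Module.nontrivial_of_finrank_pos (R := ℂ) (by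
      rw [finrank_inducedConjAlternating]; exact n.factorial_pos)
    obtain ⟨y, hy⟩ := exists_ne (0 : IndV (alternatingGroup (Fin n)).subtype
      (conjRep (alternatingGroup (Fin n))))
    let f : ρ.IntertwiningMap (inducedConjAlternating n) :=
      ⟨LinearMap.toSpanSingleton ℂ _ y ∘ₗ ℓ, fun g => by
        rw [h1 g, map_one, map_one]; rfl⟩
    refine ⟨f, (IsIrreducible.injective_or_eq_zero f).resolve_right fun h0 => ?_⟩
    have h2 : ℓ v • y = 0 := DFunLike.congr_fun h0 v
    exact (smul_ne_zero hℓ hy) h2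

end
end
-- Characters and the Frobenius characteristic.
noncomputable section

open Equiv (swap)
open Equiv.Perm
open scoped TensorProduct
open Representation

section

variable {n : ℕ}

theorem character_conjRepOn {G : Type*} [Group G] [Fintype G] [DecidableEq G] (H : Subgroup G)
    [H.Normal] [DecidablePred (· ∈ H)] (g : G) :
    (conjRepOn H).character g = (Finset.univ.filter fun x : H => g * x = x * g).card := by
  have h1 (x : H) : MulAut.conjNormal g x = x ↔ g * x = x * g := by
    rw [Subtype.ext_iff, MulAut.conjNormal_apply, mul_inv_eq_iff_eq_mul]
  let b : Module.Basis H ℂ (MonoidAlgebra ℂ H) := ⟨MonoidAlgebra.coeffLinearEquiv ℂ⟩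
  have hb (x : H) : b x = MonoidAlgebra.single x 1 := rfl
  have hr (y : MonoidAlgebra ℂ H) : b.repr y = y.coeff := rfl
  rw [character, LinearMap.trace_eq_matrix_trace ℂ b, Matrix.trace]
  simp [LinearMap.toMatrix_apply, hb, hr, conjRepOn_single, Finsupp.single_apply, h1]

theorem character_omegaRep {V : Type*} [AddCommGroup V] [Module ℂ V] [FiniteDimensional ℂ V]
    (ρ : Representation ℂ (Equiv.Perm (Fin n)) V) (σ : Equiv.Perm (Fin n)) :
    (omegaRep ρ).character σ = ((sign σ : ℤ) : ℂ) * ρ.character σ := by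
  rw [omegaRep, char_tensor, Pi.mul_apply]
  congr 1
  rw [character, signRep]
  simp

/-- Translation by the odd element `τ` permutes the centralizer of `σ` and reverses signs. -/
theorem sum_sign_centralizer {σ τ : Equiv.Perm (Fin n)} (hτ : sign τ = -1) (hc : Commute τ σ) :
    ∑ a : Equiv.Perm (Fin n) with σ * a = a * σ, ((sign a : ℤ) : ℂ) = 0 := by
  rw [← CharZero.eq_neg_self_iff, ← Finset.sum_neg_distrib, Finset.sum_filter, Finset.sum_filter,
    ← Equiv.sum_comp (Equiv.mulLeft τ)]
  refine Finset.sum_congr rfl fun a _ => ?_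
  have : σ * (τ * a) = τ * a * σ ↔ σ * a = a * σ := by
    rw [← mul_assoc, ← hc.eq, mul_assoc, mul_assoc, mul_right_inj]
  simp [hτ, this]

/-- Twice the number of even elements is the sum of `1 + sign a` over the centralizer; the signs sum
to its order or to zero. -/
theorem two_mul_card_even_centralizer (σ : Equiv.Perm (Fin n))
    [Decidable (Subgroup.centralizer {σ} ≤ alternatingGroup (Fin n))] :
    (2 * (Finset.univ.filter fun x : alternatingGroup (Fin n) => σ * x = x * σ).card : ℂ) =
      (1 + if Subgroup.centralizer {σ} ≤ alternatingGroup (Fin n) then 1 else 0) *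
        (Finset.univ.filter fun x : Equiv.Perm (Fin n) => σ * x = x * σ).card := by
  have h1 : (2 * (Finset.univ.filter fun x : alternatingGroup (Fin n) => σ * x = x * σ).card : ℂ) =
      ∑ a : Equiv.Perm (Fin n) with σ * a = a * σ, (1 + ((sign a : ℤ) : ℂ)) := by
    rw [Finset.card_filter, ← Finset.sum_subtype (Finset.univ.filter (sign · = 1))
      (fun x => by simp [mem_alternatingGroup]) (fun x => if σ * x = x * σ then 1 else 0), Finset.sum_filter,
      Finset.sum_filter, Nat.cast_sum, Finset.mul_sum]
    refine Finset.sum_congr rfl fun a _ => ?_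
    rcases Int.units_eq_one_or (sign a) with h | h
    · by_cases h' : σ * a = a * σ <;> simp [h, h', one_add_one_eq_two]
    · simp [h]
  rw [h1, Finset.sum_add_distrib]
  split_ifs with h
  · have h2 : ∀ a ∈ Finset.univ.filter fun a : Equiv.Perm (Fin n) => σ * a = a * σ,
        ((sign a : ℤ) : ℂ) = 1 := fun a ha => by
      have : a ∈ alternatingGroup (Fin n) := h (Subgroup.mem_centralizer_singleton_iff.mpr
        (Finset.mem_filter.mp ha).2.symm)
      rw [mem_alternatingGroup] at this
      simp [this]
    rw [Finset.sum_congr rfl h2]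
    simp [add_mul]
  · obtain ⟨τ, hτ, hτ'⟩ := SetLike.not_le_iff_exists.mp h
    rw [mem_alternatingGroup] at hτ'
    rw [sum_sign_centralizer ((Int.units_eq_one_or _).resolve_left hτ')
      (Subgroup.mem_centralizer_singleton_iff.mp hτ)]
    simp

/-- The cycle type of a permutation of `Fin n` as a partition of `n`. -/
def finPartition (σ : Equiv.Perm (Fin n)) : n.Partition :=
  ⟨σ.partition.parts, σ.partition.parts_pos, σ.partition.parts_sum.trans (Fintype.card_fin n)⟩

/-- By its type `σ.partition` is a partition of `Fintype.card (Fin n)`; `pPart` sees only the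
multiset of parts, so the change to `n` is harmless. -/
theorem pPart_partition (σ : Equiv.Perm (Fin n)) :
    SymmFun.pPart σ.partition = SymmFun.pPart (finPartition σ) := rfl

theorem parts_finPartition (σ : Equiv.Perm (Fin n)) : (finPartition σ).parts =
    σ.cycleType + Multiset.replicate (n - σ.cycleType.sum) 1 := by
  rw [finPartition, parts_partition, Fintype.card_fin, sum_cycleType]

theorem finPartition_eq_iff (σ τ : Equiv.Perm (Fin n)) :
    finPartition σ = finPartition τ ↔ IsConj σ τ := by
  rw [partition_eq_of_isConj, Nat.Partition.ext_iff, Nat.Partition.ext_iff]; rfl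

theorem finPartition_surjective (μ : n.Partition) : ∃ σ, finPartition σ = μ := by
  have h1 : μ.parts.filter (2 ≤ ·) + μ.parts.filter (¬ 2 ≤ ·) = μ.parts :=
    Multiset.filter_add_not _ _
  have h2 : μ.parts.filter (¬ 2 ≤ ·) = Multiset.replicate (μ.parts.filter (¬ 2 ≤ ·)).card 1 :=
    Multiset.eq_replicate_card.mpr fun i hi => by
      have := μ.parts_pos (Multiset.mem_of_mem_filter hi)
      have := Multiset.of_mem_filter hi
      omega
  have h3 : (μ.parts.filter (2 ≤ ·)).sum + (μ.parts.filter (¬ 2 ≤ ·)).card = n := by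
    have := congrArg Multiset.sum h1
    rw [Multiset.sum_add, h2, Multiset.sum_replicate, smul_eq_mul, mul_one, μ.parts_sum] at this
    exact this
  obtain ⟨σ, hσ⟩ := (exists_with_cycleType_iff (Fin n) (m := μ.parts.filter (2 ≤ ·))).mpr
    ⟨by rw [Fintype.card_fin]; omega, fun a ha => Multiset.of_mem_filter ha⟩
  refine ⟨σ, Nat.Partition.ext ?_⟩
  rw [parts_finPartition, hσ, show n - (μ.parts.filter (2 ≤ ·)).sum =
    (μ.parts.filter (¬ 2 ≤ ·)).card by omega, ← h2, h1]

theorem cycleType_sum_le (σ : Equiv.Perm (Fin n)) : σ.cycleType.sum ≤ n := by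
  rw [sum_cycleType]
  exact (Finset.card_le_univ _).trans_eq (Fintype.card_fin n)

theorem card_cycleType_le_sum (σ : Equiv.Perm (Fin n)) : σ.cycleType.card ≤ σ.cycleType.sum := by
  simpa using Multiset.card_nsmul_le_sum (a := 1) (s := σ.cycleType)
    fun x hx => (one_lt_of_mem_cycleType hx).le

theorem sign_eq_one_iff_even (σ : Equiv.Perm (Fin n)) :
    sign σ = 1 ↔ Even (n - Multiset.card (finPartition σ).parts) := by
  have h1 := cycleType_sum_le σ
  have h2 := card_cycleType_le_sum σ
  rw [sign_of_cycleType, parts_finPartition, Multiset.card_add, Multiset.card_replicate,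
    show n - (σ.cycleType.card + (n - σ.cycleType.sum)) = σ.cycleType.sum - σ.cycleType.card by
      omega, Nat.even_sub h2, ← Nat.even_add]
  rcases Nat.even_or_odd (σ.cycleType.sum + σ.cycleType.card) with h | h
  · simp [h]
  · simp [h.neg_one_pow, Nat.not_even_iff_odd.mpr h]

/-- The criterion in terms of `cycleType`, which omits fixed points, allows at most one of them.
Once fixed points are counted as parts 1, this is the distinctness condition at 1. -/
theorem centralizer_le_alternatingGroup_iff (σ : Equiv.Perm (Fin n)) :
    Subgroup.centralizer {σ} ≤ alternatingGroup (Fin n) ↔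
      finPartition σ ∈ Nat.Partition.oddDistincts n := by
  have h1 : ∀ i, (finPartition σ).parts.count i =
      σ.cycleType.count i + if i = 1 then n - σ.cycleType.sum else 0 := fun i => by
    rw [parts_finPartition, Multiset.count_add, Multiset.count_replicate]
    simp only [eq_comm]
  have h2 : σ.cycleType.count 1 = 0 := Multiset.count_eq_zero.mpr fun h =>
    absurd (one_lt_of_mem_cycleType h) (lt_irrefl 1)
  rw [centralizer_le_alternating_iff, Fintype.card_fin, Nat.Partition.oddDistincts,
    Finset.mem_inter, Nat.Partition.odds, Nat.Partition.distincts, Nat.Partition.restricted,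
    Finset.mem_filter, Finset.mem_filter, Multiset.nodup_iff_count_le_one]
  simp only [Finset.mem_univ, true_and, h1, Nat.not_even_iff_odd]
  refine and_congr ⟨fun h i hi => ?_, fun h i hi => h i ?_⟩ ⟨fun h i => ?_, fun h => ⟨?_, fun i => ?_⟩⟩
  · rw [parts_finPartition, Multiset.mem_add] at hi
    rcases hi with hi | hi
    · exact h i hi
    · rw [Multiset.eq_of_mem_replicate hi]; exact odd_one
  · rw [parts_finPartition]; exact Multiset.mem_add.mpr (Or.inl hi)
  · have := h.2 i
    split_ifs with hi
    · subst hi; omega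
    · omega
  · have := h 1
    rw [if_pos rfl] at this
    omega
  · exact le_of_add_le_left (h i)

theorem card_isConj_mul_card_centralizer (σ : Equiv.Perm (Fin n)) :
    (Finset.univ.filter fun τ : Equiv.Perm (Fin n) => finPartition τ = finPartition σ).card *
      (Finset.univ.filter fun x : Equiv.Perm (Fin n) => σ * x = x * σ).card = n.factorial := by
  have h1 := card_isConj_mul_eq σ
  rw [← nat_card_centralizer, Fintype.card_fin] at h1
  rw [← h1]
  congr 1
  · rw [← Fintype.card_subtype, ← Nat.card_eq_fintype_card]
    exact Nat.card_congr (Equiv.subtypeEquivRight fun τ => by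
      rw [finPartition_eq_iff, isConj_comm]; rfl)
  · rw [← Fintype.card_subtype, ← Nat.card_eq_fintype_card]
    exact Nat.card_congr (Equiv.subtypeEquivRight fun τ => by
      rw [Subgroup.mem_centralizer_singleton_iff, eq_comm])

theorem character_inducedConjAlternating (hn : 2 ≤ n) (σ : Equiv.Perm (Fin n)) :
    (inducedConjAlternating n).character σ =
      if sign σ = 1 then (1 + if finPartition σ ∈ Nat.Partition.oddDistincts n then (1 : ℂ) else 0) *
        (Finset.univ.filter fun x : Equiv.Perm (Fin n) => σ * x = x * σ).card else 0 := by
  obtain ⟨t, ht⟩ := exists_sign_eq_neg_one hn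
  have hfd : FiniteDimensional ℂ (MonoidAlgebra ℂ (alternatingGroup (Fin n))) :=
    Module.Finite.equiv (MonoidAlgebra.coeffLinearEquiv ℂ).symm
  have h1 : (inducedConjAlternating n).character σ =
      (1 + ((sign σ : ℤ) : ℂ)) * (conjRepOn (alternatingGroup (Fin n))).character σ := by
    rw [char_iso (inducedConjAlternatingEquiv t ht), add_mul, one_mul, ← character_omegaRep]
    exact LinearMap.trace_prodMap' _ _
  classical
  rw [h1, character_conjRepOn]
  have h2 := two_mul_card_even_centralizer σ
  simp only [centralizer_le_alternatingGroup_iff] at h2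
  rcases Int.units_eq_one_or (sign σ) with h | h
  · rw [if_pos h, h, ← h2]
    norm_num
    congr!
  · rw [if_neg (by rw [h]; decide), h]
    simp

/-- The character is constant on the class, and its factor `|C(σ)|` times the class size is `n!`,
cancelling the normalization of `ch`. -/
theorem sum_character_smul (hn : 2 ≤ n) (μ : n.Partition) :
    ∑ σ with finPartition σ = μ, (inducedConjAlternating n).character σ =
      n.factorial * if Even (n - Multiset.card μ.parts) then
        (1 + if μ ∈ Nat.Partition.oddDistincts n then 1 else 0) else 0 := by
  obtain ⟨σ, rfl⟩ := finPartition_surjective μ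
  have h1 : ∀ τ, finPartition τ = finPartition σ →
      (inducedConjAlternating n).character τ = (inducedConjAlternating n).character σ := by
    intro τ hτ
    obtain ⟨u, rfl⟩ := isConj_iff.mp ((finPartition_eq_iff _ _).mp hτ.symm)
    exact char_conj _ _ _
  rw [Finset.sum_congr rfl fun τ hτ => h1 τ (Finset.mem_filter.mp hτ).2, Finset.sum_const,
    character_inducedConjAlternating hn, ← card_isConj_mul_card_centralizer σ]
  simp only [sign_eq_one_iff_even]
  split_ifs <;> simp
  ring

/-- A permutation lies in its own centralizer, which here is contained in `A_n`. -/
theorem even_of_mem_oddDistincts {μ : n.Partition} (h : μ ∈ Nat.Partition.oddDistincts n) :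
    Even (n - Multiset.card μ.parts) := by
  obtain ⟨σ, rfl⟩ := finPartition_surjective μ
  rw [← sign_eq_one_iff_even, ← mem_alternatingGroup]
  exact (centralizer_le_alternatingGroup_iff σ).mpr h (Subgroup.mem_centralizer_singleton_iff.mpr rfl)

theorem ch_inducedConjAlternating (hn : 2 ≤ n) :
    SymmFun.ch (inducedConjAlternating n) =
        2 * ∑ μ ∈ Nat.Partition.oddDistincts n, SymmFun.pPart μ +
          ∑ μ : n.Partition with
            μ ∉ Nat.Partition.oddDistincts n ∧ Even (n - Multiset.card μ.parts),
            SymmFun.pPart μ := by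
  have h1 : ∑ σ, (inducedConjAlternating n).character σ • SymmFun.pPart σ.partition =
      ∑ μ : n.Partition, ((n.factorial : ℂ) * if Even (n - Multiset.card μ.parts) then
        (1 + if μ ∈ Nat.Partition.oddDistincts n then 1 else 0) else 0) • SymmFun.pPart μ := by
    rw [← Finset.sum_fiberwise _ finPartition]
    refine Finset.sum_congr rfl fun μ _ => ?_
    rw [← sum_character_smul hn, Finset.sum_smul]
    refine Finset.sum_congr rfl fun σ hσ => ?_
    rw [pPart_partition, (Finset.mem_filter.mp hσ).2]
  have h2 : ∑ μ ∈ Nat.Partition.oddDistincts n, SymmFun.pPart μ =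
      ∑ μ : n.Partition, if μ ∈ Nat.Partition.oddDistincts n then SymmFun.pPart μ else 0 := by
    rw [← Finset.sum_filter, Finset.filter_univ_mem]
  rw [SymmFun.ch, h1, Finset.smul_sum, h2, Finset.mul_sum, Finset.sum_filter,
    ← Finset.sum_add_distrib]
  refine Finset.sum_congr rfl fun μ _ => ?_
  rw [smul_smul, inv_mul_cancel_left₀ (Nat.cast_ne_zero.mpr n.factorial_ne_zero)]
  by_cases h : μ ∈ Nat.Partition.oddDistincts n
  · simp [h, even_of_mem_oddDistincts h, add_smul, two_mul]
  · by_cases h' : Even (n - Multiset.card μ.parts) <;> simp [h, h']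

end
end
-- Degree three.
noncomputable section

theorem Nat.Partition.parts_three (μ : Nat.Partition 3) :
    μ.parts = {3} ∨ μ.parts = {2, 1} ∨ μ.parts = {1, 1, 1} := by
  have key : ∀ d (s : Multiset ℕ), (∀ i ∈ s, 0 < i) → s.sum = d + 1 →
      ∃ a t, s = a ::ₘ t ∧ 0 < a ∧ (∀ i ∈ t, 0 < i) ∧ a + t.sum = d + 1 := by
    intro d s hs hd
    obtain ⟨a, ha⟩ : ∃ a, a ∈ s := Multiset.exists_mem_of_ne_zero (by rintro rfl; simp at hd)
    obtain ⟨t, rfl⟩ := Multiset.exists_cons_of_mem ha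
    exact ⟨a, t, rfl, hs a ha, fun i hi => hs i (Multiset.mem_cons_of_mem hi), by simpa using hd⟩
  have key0 : ∀ s : Multiset ℕ, (∀ i ∈ s, 0 < i) → s.sum = 0 → s = 0 := by
    intro s hs h
    refine Multiset.eq_zero_of_forall_notMem fun i hi => ?_
    have := Multiset.le_sum_of_mem hi
    have := hs i hi
    omega
  obtain ⟨a, s, hs, ha, hpos, hsum⟩ := key 2 μ.parts (fun i hi => μ.parts_pos hi) μ.parts_sum
  rw [hs]
  obtain h | h | h : a = 3 ∨ a = 2 ∨ a = 1 := by omega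
  · subst h
    rw [key0 s hpos (by omega)]
    exact Or.inl rfl
  · subst h
    obtain ⟨b, t, rfl, hb, hpos', hsum'⟩ := key 0 s hpos (by omega)
    obtain rfl : b = 1 := by omega
    rw [key0 t hpos' (by omega)]
    exact Or.inr (Or.inl rfl)
  · subst h
    obtain ⟨b, t, rfl, hb, hpos', hsum'⟩ := key 1 s hpos (by omega)
    obtain h | h : b = 2 ∨ b = 1 := by omega
    · subst h
      rw [key0 t hpos' (by omega)]
      exact Or.inr (Or.inl (by decide))
    · subst h
      obtain ⟨c, u, rfl, hc, hpos'', hsum''⟩ := key 0 t hpos' (by omega)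
      obtain rfl : c = 1 := by omega
      rw [key0 u hpos'' (by omega)]
      exact Or.inr (Or.inr rfl)

theorem Nat.Partition.oddDistincts_three :
    Nat.Partition.oddDistincts 3 = {⟨{3}, by simp, by simp⟩} := by
  ext μ
  rw [Finset.mem_singleton, Nat.Partition.ext_iff]
  simp only [oddDistincts, odds, restricted, distincts, Finset.mem_inter, Finset.mem_filter,
    Finset.mem_univ, true_and]
  rcases μ.parts_three with h | h | h <;> rw [h] <;> decide

theorem Nat.Partition.filter_even_three :
    (Finset.univ.filter fun μ : Nat.Partition 3 =>
      μ ∉ Nat.Partition.oddDistincts 3 ∧ Even (3 - Multiset.card μ.parts)) =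
      {⟨{1, 1, 1}, by simp, by simp⟩} := by
  ext μ
  rw [oddDistincts_three, Finset.mem_filter, Finset.mem_singleton, Finset.mem_singleton,
    Nat.Partition.ext_iff, Nat.Partition.ext_iff]
  rcases μ.parts_three with h | h | h <;> rw [h] <;> simp <;> decide

namespace SymmFun

theorem coeff_p (k : ℕ) (m : ℕ →₀ ℕ) [Decidable (∃ i, m = Finsupp.single i k)] :
    MvPowerSeries.coeff m (p k) = if ∃ i, m = Finsupp.single i k then 1 else 0 := by
  rw [MvPowerSeries.coeff_apply, p]; congr

theorem coeff_p_one_mul (m : ℕ →₀ ℕ) (f : MvPowerSeries ℕ ℂ) :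
    MvPowerSeries.coeff m (p 1 * f) =
      ∑ i ∈ m.support, MvPowerSeries.coeff (m - Finsupp.single i 1) f := by
  classical
  rw [MvPowerSeries.coeff_mul]
  simp_rw [coeff_p, ite_mul, one_mul, zero_mul]
  rw [← Finset.sum_filter]
  symm
  refine Finset.sum_bij (fun i _ => (Finsupp.single i 1, m - Finsupp.single i 1)) ?_ ?_ ?_ ?_
  · intro i hi
    have : Finsupp.single i 1 ≤ m := by
      simpa [Nat.one_le_iff_ne_zero] using hi
    exact Finset.mem_filter.mpr
      ⟨Finset.HasAntidiagonal.mem_antidiagonal.mpr (add_tsub_cancel_of_le this), i, rfl⟩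
  · intro i _ j _ h
    simpa [Finsupp.single_left_inj] using congrArg Prod.fst h
  · rintro ⟨a, b⟩ h
    obtain ⟨h, i, hi⟩ := Finset.mem_filter.mp h
    obtain rfl := Finset.HasAntidiagonal.mem_antidiagonal.mp h
    obtain rfl : a = Finsupp.single i 1 := hi
    exact ⟨i, by simp, by simp⟩
  · intros; rfl

theorem support_single_one_add (i : ℕ) (m : ℕ →₀ ℕ) :
    (Finsupp.single i 1 + m).support = insert i m.support := by
  ext j
  by_cases h : i = j <;> simp [h, eq_comm]

theorem coeff_p_one_single (i : ℕ) : MvPowerSeries.coeff (Finsupp.single i 1) (p 1) = 1 := by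
  classical
  rw [coeff_p, if_pos ⟨i, rfl⟩]

theorem coeff_p_one_mul_p_one_self (i : ℕ) :
    MvPowerSeries.coeff (Finsupp.single i 1 + Finsupp.single i 1) (p 1 * p 1) = 1 := by
  rw [coeff_p_one_mul, support_single_one_add, Finsupp.support_single _ one_ne_zero,
    Finset.insert_eq_of_mem (Finset.mem_singleton_self i), Finset.sum_singleton,
    add_tsub_cancel_left, coeff_p_one_single]

theorem coeff_p_one_mul_p_one {i j : ℕ} (h : i ≠ j) :
    MvPowerSeries.coeff (Finsupp.single i 1 + Finsupp.single j 1) (p 1 * p 1) = 2 := by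
  rw [coeff_p_one_mul, support_single_one_add, Finsupp.support_single _ one_ne_zero,
    Finset.sum_pair h, add_tsub_cancel_left, add_tsub_cancel_right, coeff_p_one_single,
    coeff_p_one_single, one_add_one_eq_two]

theorem coeff_cube_self (i : ℕ) :
    MvPowerSeries.coeff (Finsupp.single i 1 + (Finsupp.single i 1 + Finsupp.single i 1))
      (p 1 * (p 1 * p 1)) = 1 := by
  rw [coeff_p_one_mul, support_single_one_add, support_single_one_add,
    Finsupp.support_single _ one_ne_zero,
    Finset.insert_eq_of_mem (Finset.mem_singleton_self i),
    Finset.insert_eq_of_mem (Finset.mem_singleton_self i), Finset.sum_singleton,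
    add_tsub_cancel_left, coeff_p_one_mul_p_one_self]

theorem coeff_cube_pair {i j : ℕ} (h : i ≠ j) :
    MvPowerSeries.coeff (Finsupp.single i 1 + (Finsupp.single i 1 + Finsupp.single j 1))
      (p 1 * (p 1 * p 1)) = 3 := by
  rw [coeff_p_one_mul, support_single_one_add, support_single_one_add,
    Finsupp.support_single _ one_ne_zero,
    Finset.insert_eq_of_mem (Finset.mem_insert_self i _), Finset.sum_pair h,
    add_tsub_cancel_left, ← add_assoc, add_tsub_cancel_right, coeff_p_one_mul_p_one_self,
    coeff_p_one_mul_p_one h]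
  norm_num

theorem coeff_cube_distinct {i j k : ℕ} (hij : i ≠ j) (hik : i ≠ k) (hjk : j ≠ k) :
    MvPowerSeries.coeff (Finsupp.single i 1 + (Finsupp.single j 1 + Finsupp.single k 1))
      (p 1 * (p 1 * p 1)) = 6 := by
  rw [coeff_p_one_mul, support_single_one_add, support_single_one_add,
    Finsupp.support_single _ one_ne_zero, Finset.sum_insert (by simp [hij, hik]),
    Finset.sum_pair hjk, add_tsub_cancel_left,
    add_left_comm (Finsupp.single i 1), add_tsub_cancel_left,
    add_left_comm (Finsupp.single j 1), ← add_assoc (Finsupp.single i 1), add_tsub_cancel_right, coeff_p_one_mul_p_one hjk, coeff_p_one_mul_p_one hik,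
    coeff_p_one_mul_p_one hij]
  norm_num

theorem exists_of_coeff_p_one_mul_ne_zero {m : ℕ →₀ ℕ} {f : MvPowerSeries ℕ ℂ}
    (h : MvPowerSeries.coeff m (p 1 * f) ≠ 0) :
    ∃ i m', m = Finsupp.single i 1 + m' ∧ MvPowerSeries.coeff m' f ≠ 0 := by
  rw [coeff_p_one_mul] at h
  obtain ⟨i, hi, h⟩ := Finset.exists_ne_zero_of_sum_ne_zero h
  exact ⟨i, _, (add_tsub_cancel_of_le (by simpa [Nat.one_le_iff_ne_zero] using hi)).symm, h⟩

theorem exists_single_add_of_degree {m : ℕ →₀ ℕ} {d : ℕ} (h : m.degree = d + 1) :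
    ∃ i m', m = Finsupp.single i 1 + m' ∧ m'.degree = d := by
  obtain ⟨i, hi⟩ : ∃ i, m i ≠ 0 := by
    by_contra! h0
    rw [show m = 0 from Finsupp.ext h0, map_zero] at h
    omega
  have hm : m = Finsupp.single i 1 + (m - Finsupp.single i 1) :=
    (add_tsub_cancel_of_le (by simpa [Nat.one_le_iff_ne_zero] using hi)).symm
  refine ⟨i, _, hm, ?_⟩
  rw [hm, map_add, Finsupp.degree_single] at h
  omega

theorem coeff_h (k : ℕ) (m : ℕ →₀ ℕ) :
    MvPowerSeries.coeff m (h k) = if m.degree = k then 1 else 0 := rfl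

theorem coeff_e (k : ℕ) (m : ℕ →₀ ℕ) [Decidable (m.degree = k ∧ ∀ i, m i ≤ 1)] :
    MvPowerSeries.coeff m (e k) = if m.degree = k ∧ ∀ i, m i ≤ 1 then 1 else 0 := by
  rw [MvPowerSeries.coeff_apply, e]; congr

/-- The coefficients of `x³`, `x²y`, `xyz` are `2 + 1`, `0 + 3`, `0 + 6` on the left and `3(1 + 0)`,
`3(1 + 0)`, `3(1 + 1)` on the right. -/
theorem two_mul_p_three_add_cube :
    2 * p 3 + p 1 * (p 1 * p 1) = 3 * (h 3 + e 3) := by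
  classical
  ext m
  have h2 : ∀ f : MvPowerSeries ℕ ℂ, MvPowerSeries.coeff m (2 * f) = 2 * MvPowerSeries.coeff m f :=
    fun f => by rw [two_mul, two_mul, map_add]
  have h3 : ∀ f : MvPowerSeries ℕ ℂ, MvPowerSeries.coeff m (3 * f) = 3 * MvPowerSeries.coeff m f :=
    fun f => by
      rw [← two_add_one_eq_three, ← two_add_one_eq_three, add_mul, add_mul, one_mul, one_mul,
        map_add, h2]
  rw [map_add, h2, h3, map_add, coeff_h, coeff_e, coeff_p]
  have hp : ∀ {i}, m i ≠ 0 → m i ≠ 3 → ¬ ∃ a, m = Finsupp.single a 3 := by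
    rintro i h0 h3 ⟨a, rfl⟩
    rw [Finsupp.single_apply] at h0 h3
    split_ifs at h0 h3 <;> simp at h0 h3
  by_cases hd : m.degree = 3
  · obtain ⟨i, m', hm, hd'⟩ := exists_single_add_of_degree hd
    obtain ⟨j, m'', rfl, hd''⟩ := exists_single_add_of_degree hd'
    obtain ⟨k, m₀, rfl, hd₀⟩ := exists_single_add_of_degree hd''
    obtain rfl : m₀ = 0 := (Finsupp.degree_eq_zero_iff _).mp hd₀
    rw [add_zero] at hm
    -- This covers `x²y`, which arises from each of the three ways in which exactly two of the
    -- indices coincide.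
    have pair : ∀ {i j}, i ≠ j →
        m = Finsupp.single i 1 + (Finsupp.single i 1 + Finsupp.single j 1) →
        (2 * if ∃ a, m = Finsupp.single a 3 then 1 else 0) +
          MvPowerSeries.coeff m (p 1 * (p 1 * p 1)) =
        (3 : ℂ) * ((if m.degree = 3 then 1 else 0) +
          if m.degree = 3 ∧ ∀ i, m i ≤ 1 then 1 else 0) := by
      intro i j hij hm
      have hi : m i = 2 := by simp [hm, hij]
      rw [if_neg (hp (i := i) (by omega) (by omega)), if_pos hd,
        if_neg fun h => by have := h.2 i; omega, hm, coeff_cube_pair hij]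
      norm_num
    by_cases hij : i = j
    · subst hij
      by_cases hik : i = k
      · subst hik
        have hi : m i = 3 := by simp [hm]
        have hs : m = Finsupp.single i 3 := by
          rw [hm, ← Finsupp.single_add, ← Finsupp.single_add]; rfl
        rw [if_pos ⟨i, hs⟩, if_pos hd, if_neg fun h => by have := h.2 i; omega, hm,
          coeff_cube_self]
        norm_num
      · exact pair hik hm
    · by_cases hik : i = k
      · subst hik
        exact pair hij (by rw [hm, add_comm (Finsupp.single j 1)])
      · by_cases hjk : j = k
        · subst hjk
          exact pair (Ne.symm hij) (by rw [hm, add_left_comm, add_comm (Finsupp.single i 1)])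
        · have hi : m i = 1 := by simp [hm, hij, hik]
          have hle : ∀ a, m a ≤ 1 := fun a => by
            rw [hm]
            simp only [Finsupp.add_apply, Finsupp.single_apply]
            split_ifs <;> omega
          rw [if_neg (hp (i := i) (by omega) (by omega)), if_pos hd, if_pos ⟨hd, hle⟩, hm,
            coeff_cube_distinct hij hik hjk]
          norm_num
  · have hp3 : ¬ ∃ a, m = Finsupp.single a 3 := by
      rintro ⟨a, rfl⟩
      exact hd (Finsupp.degree_single a 3)
    have hc : MvPowerSeries.coeff m (p 1 * (p 1 * p 1)) = 0 := by
      by_contra hne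
      obtain ⟨i, m', rfl, hne'⟩ := exists_of_coeff_p_one_mul_ne_zero hne
      obtain ⟨j, m'', rfl, hne''⟩ := exists_of_coeff_p_one_mul_ne_zero hne'
      rw [coeff_p] at hne''
      obtain ⟨k, rfl⟩ : ∃ k, m'' = Finsupp.single k 1 := by
        by_contra h
        exact hne'' (if_neg h)
      simp [Finsupp.degree_single] at hd
    simp [hp3, hc, hd]

theorem ch_inducedConjAlternating_three :
    ch (inducedConjAlternating 3) = 3 * (h 3 + e 3) := by
  rw [ch_inducedConjAlternating (by norm_num), Nat.Partition.oddDistincts_three,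
    ← two_mul_p_three_add_cube]
  have := Nat.Partition.filter_even_three
  rw [Nat.Partition.oddDistincts_three] at this
  rw [this, Finset.sum_singleton, Finset.sum_singleton]
  simp [pPart]

end SymmFun

theorem theorem6p4 (n : ℕ) :
    -- self-conjugate
    Nonempty ((inducedConjAlternating n).Equiv (omegaRep (inducedConjAlternating n))) ∧
    -- of degree n!
    Module.finrank ℂ (Representation.IndV (alternatingGroup (Fin n)).subtype
      (conjRep (alternatingGroup (Fin n)))) = n.factorial ∧
    -- Frobenius characteristic
    (2 ≤ n →
      SymmFun.ch (inducedConjAlternating n) =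
        2 * ∑ μ ∈ Nat.Partition.oddDistincts n, SymmFun.pPart μ +
          ∑ μ : n.Partition with
            μ ∉ Nat.Partition.oddDistincts n ∧ Even (n - Multiset.card μ.parts),
            SymmFun.pPart μ) ∧
    -- decomposition into the conjugation action on the even permutations and its sign twist
    (2 ≤ n →
      Nonempty ((inducedConjAlternating n).Equiv
        ((conjRepOn (alternatingGroup (Fin n))).prod
          (omegaRep (conjRepOn (alternatingGroup (Fin n))))))) ∧
    -- every irreducible representation of the symmetric group occurs
    (n ≠ 3 →
      ∀ (V : Type*) [AddCommGroup V] [Module ℂ V]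
        (ρ : Representation ℂ (Equiv.Perm (Fin n)) V), ρ.IsIrreducible →
        ∃ f : ρ.IntertwiningMap (inducedConjAlternating n), Function.Injective f) ∧
    -- the exceptional case
    (n = 3 →
      SymmFun.ch (inducedConjAlternating n) = 3 * (SymmFun.h 3 + SymmFun.e 3)) := by
  refine ⟨nonempty_equiv_omegaRep_inducedConjAlternating n, finrank_inducedConjAlternating n,
    ch_inducedConjAlternating, fun hn => ?_,
    fun hn V _ _ ρ hρ => exists_injective_intertwiningMap ρ hn hρ, ?_⟩
  · obtain ⟨t, ht⟩ := exists_sign_eq_neg_one hn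
    exact ⟨inducedConjAlternatingEquiv t ht⟩
  · rintro rfl
    exact SymmFun.ch_inducedConjAlternating_three

end
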